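/- **Setting.** Let $n\ge 1$, $\lambda_z>0$, and let $R$ be a probability law on $(0,\infty)$. To a countable set of vehicles $C$ belong independent random variables: sojourn times $Z_C\sim\mathrm{Exp}(\lambda_z)$ and recruitment durations $U_C\sim R$. At time $0$ each of $n$ groups is processed by two vehicles, all $2n$ of them distinct; vehicle $C$ departs at time $Z_C$. When one of the two vehicles of a group departs at time $s$, the other one, $C$, becomes a recruiter; unless it departs earlier, it completes its recruitment at time $s+U_C$ (event $e^{\mathsf R}(C)$) by assigning to the group an arbitrary vehicle that is still present and processes no group. If a recruiter departs before that, the system fails (state $F$). The system is in $S_i$ $(0\le i\le n)$ if exactly $i$ groups have only one vehicle. This is the process (I-SMP) that models $\mathtt{RP\text{-}VC}_n$. **Event dynamic variables.** An event dynamic variable (EDV) is a composite expression $V=M-N$ in the above variables, together with its defining relation $M>N$ and those of $M$ and $N$; an expression that is not such a difference is simple (SRV). "$V$ follows $\alpha$" means that $V$ is composed as below, and that $\alpha$ is its conditional distribution given the defining relations of $V$. With $Z_1,Z_2$ independent sojourn times and $U,U'$ independent recruitment durations: $\dot{\exp}$ is the type of $Z_1-Z_2$; $\ddot{\exp}$ of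 $Z_1-(Z_2+U)$; $\varphi$ of $U-(Z_1-Z_2)$; $\psi$ of $U'-W$ and $\gamma$ of $W-U'$ with $W=U-(Z_1-Z_2)$. For $V=M-N$ put $\hat\Gamma(V)=\hat\Gamma(M)$, $\hat\delta(V)=\hat\delta(M)+N+\hat\delta(N)$, $\hat\xi(V)=V+\hat\delta(V)-\hat\Gamma(V)$, and for an SRV $\hat\Gamma(V)=V$, $\hat\delta(V)=0$. Write $V_1\dot\preceq V_2$ if both are EDVs with $\hat\Gamma(V_1)\ne\hat\Gamma(V_2)$, $\hat\delta(V_1)=\hat\delta(V_2)$ and $\hat\xi(V_1)\le\hat\xi(V_2)$, or if $V_1$ is an EDV and $V_2$ an SRV. A list is an EDL $\mathcal L^{(\alpha)}\langle m\rangle$ if it has $m$ entries, all following $\alpha$ and with their defining relations satisfied, and is increasing for $\dot\preceq$; an H-EDL $\mathcal H^{(\alpha;\alpha')}\langle p;q\rangle$ is a list of $p+q$ variables, increasing for $\dot\preceq$ and with their defining relations satisfied, of which the first $p$ follow $\alpha$ and the last $q$ follow $\alpha'$. The order of a recruiter is $1$ plus the number of other recruiters whose residual recruitment times are $\dot\preceq$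 its own. **Theorem (Decomposition).** Each $S_i$ with $i<n$ is decomposed into $i+2$ H-states $S_{i,0},\dots,S_{i,i+1}$, and $S_n$ has the single H-state $S_{n,0}$. To each finite history of the system (the sequence of events so far, with the recruited vehicles) belong an H-state and two lists of expressions in the $Z_C,U_C$, such that almost surely, at each time at which the system starts or an event has just occurred and it has not failed, the following holds. 1. The system is in $S_i$ if and only if the H-state is one of those of $S_i$. The two lists are the residual sojourn times of the $2n-i$ vehicles processing the groups and the residual recruitment times of the $i$ recruiters. They are - $S_{0,0}=\{[Z_1,\dots,Z_{2n}],[\,]\}$, and $S_{0,1}=\{\mathcal L^{(\ddot\exp)}\langle 2n\rangle,[\,]\}$; - $S_{i,0}=\{\mathcal L^{(\dot\exp)}\langle 2n-i\rangle,\mathcal H^{(\varphi;R)}\langle i-1;1\rangle\}$ for $1\le i\le n$; - $S_{i,j}=\{\mathcal L^{(\ddot\exp)}\langle 2n-i\rangle,\mathcal H^{(\gamma;\psi)}\langle j-1;i-(j-1)\rangle\}$ for $1\le i\le n-1$, $1\le j\le i+1$. The $k$-th entry of the second list belongs to the recruiter of order $k$. 2. Exactly one of the scheduled events occurs next. The system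 starts in $S_{0,0}$. From any H-state of $S_i$, the departure of a vehicle that is not a recruiter leads to $S_{i+1,0}$; the completion of recruitment by the recruiter of order $j$ leads to $S_{i-1,j}$; and the departure of a recruiter, and only this, leads to $F$. The H-states are time-homogeneous: for each history of positive probability, the joint distribution of the two lists, conditional on their defining relations (those of all their entries, and the $\dot\preceq$-monotonicity of the second list), is a law $\nu_{i,j}$ that depends only on the H-state $S_{i,j}$ and on $n,\lambda_z,R$, and not on the time or the way in which the H-state was entered. Let $Q(S_{i,j},s;t)$ be the probability under $\nu_{i,j}$ that one entry of the two lists is at most $t$ and strictly smaller than all others, and that the corresponding event leads to the state $s$ in the sense of 2. Then, for each H-state $S_{i,j}$ that is entered with positive probability, $\sum_s\lim_{t\to\infty}Q(S_{i,j},s;t)=1$, the sum being over all H-states and $F$. Thus $Q$ is the kernel of a time-homogeneous semi-Markov process, the decomposed SMP (D-SMP). -/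

import Mathlib

open MeasureTheory ProbabilityTheory

/-! ### Event dynamic variables -/

/-- Formal expressions in the sojourn times `Z c` and the recruitment durations `U c` of the
vehicles `c : V`.  `diff M N` is the expression `M - N`; every other expression is simple. -/
inductive EVar (V : Type*) where
  | Z (c : V)
  | U (c : V)
  | sum (M N : EVar V)
  | diff (M N : EVar V)

namespace EVar

variable {V : Type*}

/-- The value of an expression for given sojourn times `z` and recruitment durations `u`. -/
def eval (z u : V → ℝ) : EVar V → ℝ
  | Z c => z c
  | U c => u c
  | sum M N => eval z u M + eval z u N
  | diff M N => eval z u M - eval z u N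

/-- Composite expressions `M - N`. -/
def IsDiff : EVar V → Prop
  | diff _ _ => True
  | _ => False

/-- `V` is an event dynamic variable (or a positive simple random variable) for the outcome
`(z, u)`: all simple constituents are positive, and in each difference `M - N` one has `M > N`. -/
def IsEDVAt (z u : V → ℝ) : EVar V → Prop
  | diff M N => IsEDVAt z u M ∧ IsEDVAt z u N ∧ eval z u N < eval z u M
  | sum M N => IsEDVAt z u M ∧ IsEDVAt z u N
  | Z c => 0 < z c
  | U c => 0 < u c

/-- Duration. -/
def duration : EVar V → EVar V
  | diff M _ => duration M
  | W => W

/-- Reducer. -/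
def reducer (z u : V → ℝ) : EVar V → ℝ
  | diff M N => reducer z u M + (eval z u N + reducer z u N)
  | _ => 0

/-- Pivot. -/
def pivot (z u : V → ℝ) (W : EVar V) : ℝ :=
  eval z u W + reducer z u W - eval z u (duration W)

/-- `PivLE z u V₁ V₂`: `V₂` is pivotally greater than or equal to `V₁`, with the convention
that a simple random variable is pivotally greater than any difference. -/
def PivLE (z u : V → ℝ) (V₁ V₂ : EVar V) : Prop :=
  (IsDiff V₁ ∧ ¬ IsDiff V₂) ∨
  (IsDiff V₁ ∧ IsDiff V₂ ∧ duration V₁ ≠ duration V₂ ∧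
    reducer z u V₂ = reducer z u V₁ ∧ pivot z u V₁ ≤ pivot z u V₂)

end EVar

/-! ### Event distributions -/

/-- The distribution of `M - N` given `M > N`, for independent `M ∼ P` and `N ∼ Q`. -/
noncomputable def diffLaw (P Q : Measure ℝ) : Measure ℝ :=
  (cond (P.prod Q) {p : ℝ × ℝ | p.2 < p.1}).map (fun p => p.1 - p.2)

/-- Names of the distributions: the recruitment law `R`, the first and second order composite
exponential, `φ`, `ψ` and `γ`. -/
inductive EventLaw where
  | recr
  | expDot
  | expDDot
  | phi
  | psi
  | gamma

/-- The distributions, for sojourn rate `lam` and recruitment law `R`. -/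
noncomputable def EventLaw.law (lam : ℝ) (R : Measure ℝ) : EventLaw → Measure ℝ
  | recr => R
  | expDot => diffLaw (expMeasure lam) (expMeasure lam)
  | expDDot => diffLaw (expMeasure lam) (((expMeasure lam).prod R).map (fun p => p.1 + p.2))
  | phi => diffLaw R (diffLaw (expMeasure lam) (expMeasure lam))
  | psi => diffLaw R (diffLaw R (diffLaw (expMeasure lam) (expMeasure lam)))
  | gamma => diffLaw (diffLaw R (diffLaw (expMeasure lam) (expMeasure lam))) R

/-- The composition of a variable of each kind out of independent sojourn times and recruitment
durations (those of different vehicles are independent copies). -/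
def EventLaw.Form {V : Type*} : EventLaw → EVar V → Prop
  | recr, W => ∃ k, W = .U k
  | expDot, W => ∃ x b, x ≠ b ∧ W = .diff (.Z x) (.Z b)
  | expDDot, W => ∃ x a k, x ≠ a ∧ W = .diff (.Z x) (.sum (.Z a) (.U k))
  | phi, W => ∃ k b a, b ≠ a ∧ W = .diff (.U k) (.diff (.Z b) (.Z a))
  | psi, W => ∃ k l b a, k ≠ l ∧ b ≠ a ∧
      W = .diff (.U k) (.diff (.U l) (.diff (.Z b) (.Z a)))
  | gamma, W => ∃ k l b a, k ≠ l ∧ b ≠ a ∧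
      W = .diff (.diff (.U k) (.diff (.Z b) (.Z a))) (.U l)

/-- The vehicles' sojourn times `Z c` (exponential with rate `lam`) and recruitment durations
`U c` (law `R`) are independent random variables. -/
structure IsSeSVC {Ω V : Type*} [MeasurableSpace Ω] (μ : Measure Ω) (Z U : V → Ω → ℝ)
    (lam : ℝ) (R : Measure ℝ) : Prop where
  measurable_Z : ∀ c, Measurable (Z c)
  measurable_U : ∀ c, Measurable (U c)
  indep : iIndepFun (Sum.elim Z U) μ
  law_Z : ∀ c, μ.map (Z c) = expMeasure lam
  law_U : ∀ c, μ.map (U c) = R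

section Lists

variable {Ω V : Type*} [MeasurableSpace Ω] (μ : Measure Ω) (Z U : V → Ω → ℝ)
  (lam : ℝ) (R : Measure ℝ)

/-- `W ∼ α`: the variable `W` is composed as prescribed by `α`, and, given that it is an event
dynamic variable, its distribution is `α`. -/
def Follows (α : EventLaw) (W : EVar V) : Prop :=
  α.Form W ∧
  (cond μ {ω | W.IsEDVAt (fun c => Z c ω) (fun c => U c ω)}).map
    (fun ω => W.eval (fun c => Z c ω) (fun c => U c ω)) = α.law lam R

/-- `l` is, at the outcome `ω`, an event dynamic list whose members follow `α`. -/
def IsEDL (ω : Ω) (α : EventLaw) {m : ℕ} (l : Fin m → EVar V) : Prop :=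
  (∀ k, (l k).IsEDVAt (fun c => Z c ω) (fun c => U c ω) ∧ Follows μ Z U lam R α (l k)) ∧
  ∀ k k', k < k' → EVar.PivLE (fun c => Z c ω) (fun c => U c ω) (l k) (l k')

/-- `l` is, at the outcome `ω`, a heterogeneous event dynamic list: the first `p` members
follow `α`, the last `q` members follow `α'`. -/
def IsHEDL (ω : Ω) (α α' : EventLaw) (p q : ℕ) {m : ℕ} (l : Fin m → EVar V) : Prop :=
  m = p + q ∧
  (∀ k, (l k).IsEDVAt (fun c => Z c ω) (fun c => U c ω)) ∧
  (∀ k : Fin m, (k : ℕ) < p → Follows μ Z U lam R α (l k)) ∧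
  (∀ k : Fin m, p ≤ (k : ℕ) → Follows μ Z U lam R α' (l k)) ∧
  ∀ k k', k < k' → EVar.PivLE (fun c => Z c ω) (fun c => U c ω) (l k) (l k')

end Lists

/-! ### The dynamics of the redundancy-based processing of `n` groups -/

/-- A group is processed by two vehicles, or by one vehicle `c` which is recruiting since
time `s`. -/
inductive GroupStatus (V : Type*) where
  | pair (c d : V)
  | single (c : V) (s : ℝ)

/-- Vehicle `c` processes the group. -/
def GroupStatus.Has {V : Type*} : GroupStatus V → V → Prop
  | pair c d, x => x = c ∨ x = d
  | single c _, x => x = c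

def GroupStatus.isSingle {V : Type*} : GroupStatus V → Bool
  | pair _ _ => false
  | single _ _ => true

/-- A configuration: the current time and the status of each of the `n` groups. -/
structure VCConfig (V : Type*) (n : ℕ) where
  time : ℝ
  status : Fin n → GroupStatus V

namespace VCConfig

variable {V : Type*} {n : ℕ}

def Active (X : VCConfig V n) (c : V) : Prop := ∃ g, (X.status g).Has c

/-- The index `i` of the state `S_i`: the number of groups with only one vehicle. -/
def level (X : VCConfig V n) : ℕ :=
  (Finset.univ.filter (fun g => (X.status g).isSingle = true)).card

end VCConfig

/-- The events: departure of a vehicle, completion of a recruitment by a vehicle. -/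
inductive VCEvent (V : Type*) where
  | depart (c : V)
  | recruit (c : V)

/-- An event, together with the recruited vehicle `y` if it is a recruitment. -/
inductive Move (V : Type*) where
  | depart (c : V)
  | recruit (c y : V)

/-- The events that are scheduled in configuration `X`, with their times of occurrence. -/
inductive Pending {V : Type*} {n : ℕ} (z u : V → ℝ) (X : VCConfig V n) :
    VCEvent V → ℝ → Prop where
  | depart {c : V} (hc : X.Active c) : Pending z u X (.depart c) (z c)
  | recruit {g : Fin n} {c : V} {s : ℝ} (hg : X.status g = .single c s) :
      Pending z u X (.recruit c) (s + u c)

/-- Event `e` occurs, at time `t`, before all other scheduled events. -/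
def IsNext {V : Type*} {n : ℕ} (z u : V → ℝ) (X : VCConfig V n) (e : VCEvent V) (t : ℝ) :
    Prop :=
  Pending z u X e t ∧ ∀ e' t', Pending z u X e' t' → e' ≠ e → t < t'

/-- One transition.  The result `none` is the failure state `F`.  A recruiter may recruit any
vehicle `y` that is still present and does not process a group. -/
inductive Step {V : Type*} {n : ℕ} (z u : V → ℝ) (X : VCConfig V n) :
    Move V → Option (VCConfig V n) → Prop where
  | departLeft {g : Fin n} {c d : V} (hg : X.status g = .pair c d)
      (hn : IsNext z u X (.depart c) (z c)) :
      Step z u X (.depart c) (some ⟨z c, Function.update X.status g (.single d (z c))⟩)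
  | departRight {g : Fin n} {c d : V} (hg : X.status g = .pair c d)
      (hn : IsNext z u X (.depart d) (z d)) :
      Step z u X (.depart d) (some ⟨z d, Function.update X.status g (.single c (z d))⟩)
  | recruit {g : Fin n} {c y : V} {s : ℝ} (hg : X.status g = .single c s)
      (hn : IsNext z u X (.recruit c) (s + u c)) (hy : ¬ X.Active y) (hz : s + u c < z y) :
      Step z u X (.recruit c y)
        (some ⟨s + u c, Function.update X.status g (.pair c y)⟩)
  | fail {g : Fin n} {c : V} {s : ℝ} (hg : X.status g = .single c s)
      (hn : IsNext z u X (.depart c) (z c)) : Step z u X (.depart c) none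

/-- `Run z u alloc h X`: starting at time `0` with the vehicles `alloc g 0`, `alloc g 1` on each
group `g`, the system goes through the history `h` and is then in configuration `X`. -/
inductive Run {V : Type*} {n : ℕ} (z u : V → ℝ) (alloc : Fin n → Fin 2 → V) :
    List (Move V) → Option (VCConfig V n) → Prop where
  | start : Run z u alloc [] (some ⟨0, fun g => .pair (alloc g 0) (alloc g 1)⟩)
  | step {h : List (Move V)} {X : VCConfig V n} {m : Move V} {X' : Option (VCConfig V n)}
      (hr : Run z u alloc h (some X)) (hs : Step z u X m X') : Run z u alloc (h ++ [m]) X'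

/-! ### H-states -/

/-- The index pairs `(i, j)` of the H-states `S_{i,j}` into which `S_i` is decomposed. -/
def hStates (n i : ℕ) : Finset (ℕ × ℕ) :=
  if i < n then (Finset.range (i + 2)).image (fun j => (i, j)) else {(n, 0)}

/-- The two lists describing an H-state `S_{i,j}`, with the vehicles they refer to. -/
structure HDesc (V : Type*) (n i : ℕ) where
  vehicle : Fin (2 * n - i) → V
  sojourn : Fin (2 * n - i) → EVar V
  recruiter : Fin i → V
  recruitment : Fin i → EVar V

/-- The order of the `k`-th recruiter: its rank with respect to the pivotal comparison of the
residual recruitment times. -/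
noncomputable def HDesc.order {V : Type*} {n i : ℕ} (z u : V → ℝ) (d : HDesc V n i)
    (k : Fin i) : ℕ :=
  {l : Fin i | l ≠ k ∧ EVar.PivLE z u (d.recruitment l) (d.recruitment k)}.ncard + 1

/-- The lists of `d` are the residual sojourn times of the vehicles that process the groups in
configuration `X`, the recruiters coming first, and the residual recruitment times of the
recruiters. -/
structure HDesc.Describes {V : Type*} {n i : ℕ} (z u : V → ℝ) (X : VCConfig V n)
    (d : HDesc V n i) : Prop where
  vehicle_inj : Function.Injective d.vehicle
  vehicle_iff : ∀ c, X.Active c ↔ ∃ k, d.vehicle k = c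
  sojourn_eq : ∀ k, (d.sojourn k).eval z u = z (d.vehicle k) - X.time
  recruiter_inj : Function.Injective d.recruiter
  recruiter_iff : ∀ c, (∃ g s, X.status g = .single c s) ↔ ∃ k, d.recruiter k = c
  recruitment_eq : ∀ k g s, X.status g = .single (d.recruiter k) s →
    (d.recruitment k).eval z u = s + u (d.recruiter k) - X.time
  recruiter_first : ∀ (k : Fin (2 * n - i)) (l : Fin i), (k : ℕ) = l →
    d.vehicle k = d.recruiter l

/-- At the outcome `ω`, the lists of `d` are those of the H-state `S_{i,j}`. -/
def HDesc.IsHState {Ω V : Type*} [MeasurableSpace Ω] (μ : Measure Ω) (Z U : V → Ω → ℝ)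
    (lam : ℝ) (R : Measure ℝ) (ω : Ω) {n i : ℕ} (j : ℕ) (d : HDesc V n i) : Prop :=
  if j = 0 then
    if i = 0 then ∀ k, d.sojourn k = .Z (d.vehicle k)
    else IsEDL μ Z U lam R ω .expDot d.sojourn ∧
      IsHEDL μ Z U lam R ω .phi .recr (i - 1) 1 d.recruitment
  else IsEDL μ Z U lam R ω .expDDot d.sojourn ∧
    IsHEDL μ Z U lam R ω .gamma .psi (j - 1) (i - (j - 1)) d.recruitment

/-- The defining relations of the two lists: all entries are event dynamic variables, and the
residual recruitment times are pivotally increasing. -/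
def HDesc.Relations {V : Type*} {n i : ℕ} (z u : V → ℝ) (d : HDesc V n i) : Prop :=
  (∀ k, (d.sojourn k).IsEDVAt z u) ∧ (∀ k, (d.recruitment k).IsEDVAt z u) ∧
  ∀ k l, k < l → EVar.PivLE z u (d.recruitment k) (d.recruitment l)

/-- Values of the residual sojourn times and the residual recruitment times. -/
abbrev Residuals (n i : ℕ) : Type := (Fin (2 * n - i) → ℝ) × (Fin i → ℝ)

def HDesc.values {V : Type*} {n i : ℕ} (z u : V → ℝ) (d : HDesc V n i) : Residuals n i :=
  (fun k => (d.sojourn k).eval z u, fun k => (d.recruitment k).eval z u)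

/-- The joint distribution of the two lists, given their defining relations. -/
noncomputable def HDesc.jointLaw {Ω V : Type*} [MeasurableSpace Ω] (μ : Measure Ω)
    (Z U : V → Ω → ℝ) {n i : ℕ} (d : HDesc V n i) : Measure (Residuals n i) :=
  (cond μ {ω | d.Relations (fun c => Z c ω) (fun c => U c ω)}).map
    (fun ω => d.values (fun c => Z c ω) (fun c => U c ω))

/-! ### The decomposed semi-Markov process -/

/-- The states of the decomposed process: the H-states `S_{i,j}` and the failure state `F`. -/
inductive DState where
  | H (i j : ℕ)
  | F
deriving DecidableEq

/-- The set of all states of the decomposed process. -/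
def dStates (n : ℕ) : Finset DState :=
  insert .F ((Finset.range (n + 1)).biUnion
    (fun i => (hStates n i).image (fun q => DState.H q.1 q.2)))

/-- The state entered from any `S_{i,j}` if the given entry of the two lists runs out first:
`F` after the departure of a recruiter, `S_{i+1,0}` after the departure of another vehicle,
and `S_{i-1,k}` if the recruiter of order `k` completes its recruitment. -/
def dTarget (n i : ℕ) : Fin (2 * n - i) ⊕ Fin i → DState
  | Sum.inl k => if (k : ℕ) < i then .F else .H (i + 1) 0
  | Sum.inr k => .H (i - 1) (k + 1)

/-- The semi-Markov kernel of the decomposed process, for given laws `ν i j` of the residual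
times in the H-states: the probability to go from `S_{i,j}` to `s` within time `t`. -/
noncomputable def dKernel (n : ℕ) (ν : ∀ i _j : ℕ, Measure (Residuals n i)) (i j : ℕ)
    (s : DState) (t : ℝ) : ENNReal :=
  ν i j {p | ∃ e, dTarget n i e = s ∧ Sum.elim p.1 p.2 e ≤ t ∧
    ∀ e', e' ≠ e → Sum.elim p.1 p.2 e < Sum.elim p.1 p.2 e'}

/-! ### Laws of conditioned differences -/

section Cond

variable {Ω α β : Type*} [MeasurableSpace Ω] [MeasurableSpace α] [MeasurableSpace β]

/-! The history alone, without the outcome, determines which vehicles process the groups, the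
recruiting groups in the order of the departures they suffered (the queue), and whether the last
event was a recruitment, and by whom. The current time is therefore an explicit expression: `0` at
the start, `Z_b` after a departure, `Z_b + U_l` after a recruitment. A residual sojourn time is
`Z_x` minus this time, and a residual recruitment time is `Z_a + U_k` minus it, where `a` is the
departed vehicle that `k` makes up for. After a departure the latter is `U_k - (Z_b - Z_a)`, of type
φ, or `U_k` for the newest recruiter. After a recruitment it is `(U_k - (Z_b - Z_a)) - U_l` (γ) if
`Z_a < Z_b`, and `U_k - (U_l - (Z_a - Z_b))` (ψ) if `Z_b < Z_a`.

In each composite form the reducer is the current time and the pivot is `Z_a`, so the pivotal order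
is the order of departures. If the recruiter of order `j` completes, exactly `j - 1` remaining
recruiters owe their task to an earlier departure. These give the γ entries and the others the ψ
entries. The dynamics enter through an invariant, `SymConfig.Matches`, which is preserved by
departures and recruitments.

For the laws, no variable occurs twice in an entry, so `IsSeSVC.condLaw_diff` computes each
conditional law recursively. In the joint law the history enters only through the choice of distinct
labels. Any choice of distinct independent variables has the same product law, whence
`Labels.jointLaw_eq`. Finally, every entry carries its own atomless sojourn time, so the entries are
almost surely distinct; exactly one is minimal, and the kernel has mass one (`sum_iSup_dKernel`). -/

theorem map_cond_preimage {μ : Measure Ω} {f : Ω → α} (hf : Measurable f) {S : Set α}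
    (hS : MeasurableSet S) : (cond μ (f ⁻¹' S)).map f = cond (μ.map f) S := by
  simp only [ProbabilityTheory.cond, Measure.map_apply hf hS, Measure.map_smul, Measure.restrict_map hf hS]

/-- By independence both `μ (A ∩ B)` and the measure of the restricted rectangle factor, so `M` and
`N` stay independent under the conditioning. Null events need no separate case, since conditioning
on them gives the zero measure on both sides. -/
theorem map_cond_inter_prod {Ω : Type*} {m₁ m₂ mΩ : MeasurableSpace Ω} {μ : Measure Ω}
    [IsProbabilityMeasure μ] (h₁ : m₁ ≤ mΩ) (h₂ : m₂ ≤ mΩ) (hi : Indep m₁ m₂ μ)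
    {A B : Set Ω} (hA : MeasurableSet[m₁] A) (hB : MeasurableSet[m₂] B) {M : Ω → α} {N : Ω → β}
    (hM : Measurable[m₁] M) (hN : Measurable[m₂] N) :
    (cond μ (A ∩ B)).map (fun ω => (M ω, N ω)) = ((cond μ A).map M).prod ((cond μ B).map N) := by
  have hi' := (Indep_iff m₁ m₂ μ).1 hi
  have hM' : Measurable M := hM.mono h₁ le_rfl
  have hN' : Measurable N := hN.mono h₂ le_rfl
  symm
  apply Measure.prod_eq
  intro s t hs ht
  rw [Measure.map_apply (hM'.prodMk hN') (hs.prod ht), Measure.map_apply hM' hs,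
    Measure.map_apply hN' ht, cond_apply ((h₁ _ hA).inter (h₂ _ hB)), cond_apply (h₁ _ hA),
    cond_apply (h₂ _ hB), hi' _ _ hA hB]
  have e : A ∩ B ∩ (fun ω => (M ω, N ω)) ⁻¹' s ×ˢ t = (A ∩ M ⁻¹' s) ∩ (B ∩ N ⁻¹' t) := by
    ext ω
    simp only [Set.mem_inter_iff, Set.mem_preimage, Set.mem_prod]
    tauto
  rw [e, hi' _ _ (hA.inter (hM hs)) (hB.inter (hN ht)),
    ENNReal.mul_inv (Or.inr (measure_ne_top _ _)) (Or.inl (measure_ne_top _ _))]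
  ring

/-- Fubini: the slices of the diagonal are singletons, so it suffices that one of the two laws is
atomless. -/
theorem ae_ne_of_indepFun {μ : Measure Ω} [IsProbabilityMeasure μ] {X Y : Ω → ℝ}
    (hX : Measurable X) (hY : Measurable Y) (h : IndepFun X Y μ) [NullSingletonClass (μ.map X)] :
    ∀ᵐ ω ∂μ, X ω ≠ Y ω := by
  have e := (indepFun_iff_map_prod_eq_prod_map_map hY.aemeasurable hX.aemeasurable).1 h.symm
  have hd : MeasurableSet {p : ℝ × ℝ | p.2 = p.1} := measurableSet_eq_fun measurable_snd
    measurable_fst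
  have : IsProbabilityMeasure (μ.map X) := Measure.isProbabilityMeasure_map hX.aemeasurable
  have h0 : (μ.map (fun ω => (Y ω, X ω))) {p : ℝ × ℝ | p.2 = p.1} = 0 := by
    rw [e, Measure.measure_prod_null hd]
    refine Filter.Eventually.of_forall fun y => ?_
    have : Prod.mk y ⁻¹' {p : ℝ × ℝ | p.2 = p.1} = {y} := by ext; simp
    simp [this]
  rw [Measure.map_apply (hY.prodMk hX) hd] at h0
  rw [ae_iff]
  simpa using h0

theorem cond_of_ae_mem {μ : Measure Ω} [IsProbabilityMeasure μ] {A : Set Ω} (h : ∀ᵐ ω ∂μ, ω ∈ A) :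
    cond μ A = μ := by
  have h0 : μ A = 1 := by
    rw [measure_congr (Filter.eventuallyEq_univ.2 h : A =ᵐ[μ] Set.univ), measure_univ]
  rw [ProbabilityTheory.cond, h0, inv_one, one_smul, Measure.restrict_eq_self_of_ae_mem h]

end Cond

theorem expMeasure_absolutelyContinuous (r : ℝ) : expMeasure r ≪ volume :=
  withDensity_absolutelyContinuous _ _

theorem nullSingletonClass_expMeasure (r : ℝ) : NullSingletonClass (expMeasure r) :=
  ⟨fun _ => expMeasure_absolutelyContinuous r (measure_singleton _)⟩

theorem expMeasure_Iic_zero (r : ℝ) : expMeasure r (Set.Iic 0) = 0 := by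
  have h0 : expMeasure r (Set.Iio 0) = 0 := by
    rw [expMeasure, gammaMeasure, withDensity_apply _ measurableSet_Iio]
    rw [setLIntegral_congr_fun (g := fun _ => 0) measurableSet_Iio
      (fun x hx => gammaPDF_of_neg hx)]
    simp
  have h1 : expMeasure r {0} = 0 := (nullSingletonClass_expMeasure r).measure_singleton 0
  rw [← Set.Iio_union_right]
  exact measure_union_null h0 h1

/-! ### Expressions as functions of the variables occurring in them -/

namespace EVar

variable {Ω V : Type*}

/-- The variables that occur in an expression. -/
def vars : EVar V → Set (V ⊕ V)
  | Z c => {Sum.inl c}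
  | U c => {Sum.inr c}
  | sum M N => vars M ∪ vars N
  | diff M N => vars M ∪ vars N

/-- The σ-algebra is arbitrary so that it can be the one generated by the variables of `W`;
independence of expressions without common variables follows from this. -/
theorem measurable_eval_of {m : MeasurableSpace Ω} {Z U : V → Ω → ℝ} (W : EVar V)
    (h : ∀ x ∈ W.vars, Measurable (Sum.elim Z U x)) :
    Measurable (fun ω => W.eval (fun c => Z c ω) (fun c => U c ω)) := by
  induction W with
  | Z c => exact h (Sum.inl c) rfl
  | U c => exact h (Sum.inr c) rfl
  | sum M N hM hN =>
    exact (hM fun x hx => h x (Or.inl hx)).add (hN fun x hx => h x (Or.inr hx))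
  | diff M N hM hN =>
    exact (hM fun x hx => h x (Or.inl hx)).sub (hN fun x hx => h x (Or.inr hx))

theorem measurableSet_isEDVAt_of {m : MeasurableSpace Ω} {Z U : V → Ω → ℝ} (W : EVar V)
    (h : ∀ x ∈ W.vars, Measurable (Sum.elim Z U x)) :
    MeasurableSet {ω | W.IsEDVAt (fun c => Z c ω) (fun c => U c ω)} := by
  induction W with
  | Z c => exact measurableSet_lt measurable_const (h (Sum.inl c) rfl)
  | U c => exact measurableSet_lt measurable_const (h (Sum.inr c) rfl)
  | sum M N hM hN =>
    exact (hM fun x hx => h x (Or.inl hx)).inter (hN fun x hx => h x (Or.inr hx))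
  | diff M N hM hN =>
    exact (hM fun x hx => h x (Or.inl hx)).inter ((hN fun x hx => h x (Or.inr hx)).inter
      (measurableSet_lt (measurable_eval_of N fun x hx => h x (Or.inr hx))
        (measurable_eval_of M fun x hx => h x (Or.inl hx))))

/-- The distribution of an expression given its defining relations. -/
noncomputable def condLaw [MeasurableSpace Ω] (μ : Measure Ω) (Z U : V → Ω → ℝ) (W : EVar V) :
    Measure ℝ :=
  (cond μ {ω | W.IsEDVAt (fun c => Z c ω) (fun c => U c ω)}).map
    (fun ω => W.eval (fun c => Z c ω) (fun c => U c ω))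

end EVar

/-- The σ-algebra generated by a set of variables. -/
@[reducible]
def varsSigma {Ω V : Type*} (Z U : V → Ω → ℝ) (S : Set (V ⊕ V)) : MeasurableSpace Ω :=
  ⨆ x ∈ S, MeasurableSpace.comap (Sum.elim Z U x) inferInstance

theorem measurable_varsSigma {Ω V : Type*} (Z U : V → Ω → ℝ) (S : Set (V ⊕ V)) :
    ∀ x ∈ S, Measurable[varsSigma Z U S] (Sum.elim Z U x) := fun x hx =>
  measurable_iff_comap_le.2
    (le_iSup₂ (f := fun x (_ : x ∈ S) =>
      MeasurableSpace.comap (Sum.elim Z U x) (inferInstance : MeasurableSpace ℝ)) x hx)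

/-! ### Conditional laws of expressions under independence -/

namespace IsSeSVC

variable {Ω V : Type*} [MeasurableSpace Ω] {μ : Measure Ω} {Z U : V → Ω → ℝ}
  {lam : ℝ} {R : Measure ℝ}

theorem measurable_elim (H : IsSeSVC μ Z U lam R) (x : V ⊕ V) : Measurable (Sum.elim Z U x) := by
  cases x with
  | inl c => exact H.measurable_Z c
  | inr c => exact H.measurable_U c

theorem varsSigma_le (H : IsSeSVC μ Z U lam R) (S : Set (V ⊕ V)) :
    varsSigma Z U S ≤ ‹MeasurableSpace Ω› :=
  iSup₂_le fun x _ => measurable_iff_comap_le.1 (H.measurable_elim x)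

theorem indep_varsSigma (H : IsSeSVC μ Z U lam R) {S T : Set (V ⊕ V)} (h : Disjoint S T) :
    Indep (varsSigma Z U S) (varsSigma Z U T) μ :=
  indep_iSup_of_disjoint (fun x => measurable_iff_comap_le.1 (H.measurable_elim x))
    ((iIndepFun_iff_iIndep _ _ _).1 H.indep) h

theorem measurable_eval (H : IsSeSVC μ Z U lam R) (W : EVar V) :
    Measurable (fun ω => W.eval (fun c => Z c ω) (fun c => U c ω)) :=
  W.measurable_eval_of fun x _ => H.measurable_elim x

theorem ae_pos_Z (H : IsSeSVC μ Z U lam R) (c : V) : ∀ᵐ ω ∂μ, 0 < Z c ω := by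
  have h := expMeasure_Iic_zero lam
  rw [← H.law_Z c, Measure.map_apply (H.measurable_Z c) measurableSet_Iic] at h
  rw [ae_iff]
  simpa [Set.preimage] using h

theorem ae_pos_U (H : IsSeSVC μ Z U lam R) (hR : R (Set.Iic 0) = 0) (c : V) :
    ∀ᵐ ω ∂μ, 0 < U c ω := by
  rw [← H.law_U c, Measure.map_apply (H.measurable_U c) measurableSet_Iic] at hR
  rw [ae_iff]
  simpa [Set.preimage] using hR

variable [IsProbabilityMeasure μ]

theorem map_pair (H : IsSeSVC μ Z U lam R) {M N : EVar V} (h : Disjoint M.vars N.vars) :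
    (cond μ ({ω | M.IsEDVAt (fun c => Z c ω) (fun c => U c ω)} ∩
      {ω | N.IsEDVAt (fun c => Z c ω) (fun c => U c ω)})).map
        (fun ω => (M.eval (fun c => Z c ω) (fun c => U c ω),
          N.eval (fun c => Z c ω) (fun c => U c ω))) =
      (M.condLaw μ Z U).prod (N.condLaw μ Z U) :=
  map_cond_inter_prod (H.varsSigma_le _) (H.varsSigma_le _) (H.indep_varsSigma h)
    (M.measurableSet_isEDVAt_of (measurable_varsSigma Z U _))
    (N.measurableSet_isEDVAt_of (measurable_varsSigma Z U _))
    (M.measurable_eval_of (measurable_varsSigma Z U _))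
    (N.measurable_eval_of (measurable_varsSigma Z U _))

/-- Conditioning in two stages: given the defining relations of `M` and of `N`, the pair of values
is independent; the remaining relation `M > N` is then the conditioning in `diffLaw`. -/
theorem condLaw_diff (H : IsSeSVC μ Z U lam R) {M N : EVar V} (h : Disjoint M.vars N.vars) :
    (EVar.diff M N).condLaw μ Z U = diffLaw (M.condLaw μ Z U) (N.condLaw μ Z U) := by
  have hS : MeasurableSet {p : ℝ × ℝ | p.2 < p.1} := measurableSet_lt measurable_snd measurable_fst
  have hf := (H.measurable_eval M).prodMk (H.measurable_eval N)
  have hA := M.measurableSet_isEDVAt_of (Z := Z) (U := U) fun x _ => H.measurable_elim x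
  have hB := N.measurableSet_isEDVAt_of (Z := Z) (U := U) fun x _ => H.measurable_elim x
  rw [diffLaw, ← H.map_pair h, ← map_cond_preimage hf hS,
    cond_cond_eq_cond_inter (hA.inter hB) (hf hS),
    Measure.map_map (by fun_prop) hf, EVar.condLaw, Set.inter_assoc]
  rfl

theorem condLaw_sum (H : IsSeSVC μ Z U lam R) {M N : EVar V} (h : Disjoint M.vars N.vars) :
    (EVar.sum M N).condLaw μ Z U =
      ((M.condLaw μ Z U).prod (N.condLaw μ Z U)).map (fun p => p.1 + p.2) := by
  have hf := (H.measurable_eval M).prodMk (H.measurable_eval N)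
  rw [← H.map_pair h, Measure.map_map (by fun_prop) hf, EVar.condLaw]
  rfl

theorem condLaw_Z (H : IsSeSVC μ Z U lam R) (c : V) :
    (EVar.Z c).condLaw μ Z U = expMeasure lam := by
  have h : ∀ᵐ ω ∂μ, ω ∈ {ω | (EVar.Z c).IsEDVAt (fun c => Z c ω) (fun c => U c ω)} :=
    H.ae_pos_Z c
  rw [EVar.condLaw, cond_of_ae_mem h]
  exact H.law_Z c

theorem condLaw_U (H : IsSeSVC μ Z U lam R) (hR : R (Set.Iic 0) = 0) (c : V) :
    (EVar.U c).condLaw μ Z U = R := by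
  have h : ∀ᵐ ω ∂μ, ω ∈ {ω | (EVar.U c).IsEDVAt (fun c => Z c ω) (fun c => U c ω)} :=
    H.ae_pos_U hR c
  rw [EVar.condLaw, cond_of_ae_mem h]
  exact H.law_U c

theorem follows_recr (H : IsSeSVC μ Z U lam R) (hR : R (Set.Iic 0) = 0) (k : V) :
    Follows μ Z U lam R .recr (.U k) :=
  ⟨⟨k, rfl⟩, H.condLaw_U hR k⟩

theorem follows_expDot (H : IsSeSVC μ Z U lam R) {x b : V} (h : x ≠ b) :
    Follows μ Z U lam R .expDot (.diff (.Z x) (.Z b)) := by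
  refine ⟨⟨x, b, h, rfl⟩, ?_⟩
  change EVar.condLaw μ Z U _ = _
  rw [H.condLaw_diff (by simpa [EVar.vars] using h), H.condLaw_Z, H.condLaw_Z]
  rfl

theorem follows_expDDot (H : IsSeSVC μ Z U lam R) (hR : R (Set.Iic 0) = 0) {x a : V} (h : x ≠ a)
    (k : V) : Follows μ Z U lam R .expDDot (.diff (.Z x) (.sum (.Z a) (.U k))) := by
  refine ⟨⟨x, a, k, h, rfl⟩, ?_⟩
  change EVar.condLaw μ Z U _ = _
  rw [H.condLaw_diff (by simpa [EVar.vars] using h), H.condLaw_sum (by simp [EVar.vars]),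
    H.condLaw_Z, H.condLaw_Z, H.condLaw_U hR]
  rfl

theorem condLaw_phi (H : IsSeSVC μ Z U lam R) (hR : R (Set.Iic 0) = 0) (k : V) {b a : V}
    (h : b ≠ a) : EVar.condLaw μ Z U (.diff (.U k) (.diff (.Z b) (.Z a))) =
      EventLaw.phi.law lam R := by
  rw [H.condLaw_diff (by simp [EVar.vars]), H.condLaw_diff (by simpa [EVar.vars] using h),
    H.condLaw_Z, H.condLaw_Z, H.condLaw_U hR]
  rfl

theorem follows_phi (H : IsSeSVC μ Z U lam R) (hR : R (Set.Iic 0) = 0) (k : V) {b a : V}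
    (h : b ≠ a) : Follows μ Z U lam R .phi (.diff (.U k) (.diff (.Z b) (.Z a))) :=
  ⟨⟨k, b, a, h, rfl⟩, H.condLaw_phi hR k h⟩

theorem follows_psi (H : IsSeSVC μ Z U lam R) (hR : R (Set.Iic 0) = 0) {k l b a : V} (hk : k ≠ l)
    (h : b ≠ a) :
    Follows μ Z U lam R .psi (.diff (.U k) (.diff (.U l) (.diff (.Z b) (.Z a)))) := by
  refine ⟨⟨k, l, b, a, hk, h, rfl⟩, ?_⟩
  change EVar.condLaw μ Z U _ = _
  rw [H.condLaw_diff (by simpa [EVar.vars] using hk), H.condLaw_phi hR l h, H.condLaw_U hR]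
  rfl

theorem follows_gamma (H : IsSeSVC μ Z U lam R) (hR : R (Set.Iic 0) = 0) {k l b a : V} (hk : k ≠ l)
    (h : b ≠ a) :
    Follows μ Z U lam R .gamma (.diff (.diff (.U k) (.diff (.Z b) (.Z a))) (.U l)) := by
  refine ⟨⟨k, l, b, a, hk, h, rfl⟩, ?_⟩
  change EVar.condLaw μ Z U _ = _
  rw [H.condLaw_diff (by simpa [EVar.vars] using hk.symm), H.condLaw_phi hR k h, H.condLaw_U hR]
  rfl

theorem ae_Z_ne (H : IsSeSVC μ Z U lam R) {a : V} {W : EVar V} (h : Sum.inl a ∉ W.vars) :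
    ∀ᵐ ω ∂μ, Z a ω ≠ W.eval (fun c => Z c ω) (fun c => U c ω) := by
  have hi : IndepFun (Z a) (fun ω => W.eval (fun c => Z c ω) (fun c => U c ω)) μ := by
    rw [IndepFun_iff_Indep]
    refine indep_of_indep_of_le_left (indep_of_indep_of_le_right (H.indep_varsSigma
      (S := {Sum.inl a}) (T := W.vars) (by simpa using h)) ?_) ?_
    · exact measurable_iff_comap_le.1 (W.measurable_eval_of (measurable_varsSigma Z U _))
    · exact measurable_iff_comap_le.1 (measurable_varsSigma Z U {Sum.inl a} (Sum.inl a) rfl)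
  have : NullSingletonClass (μ.map (Z a)) := by rw [H.law_Z]; exact nullSingletonClass_expMeasure lam
  exact ae_ne_of_indepFun (H.measurable_Z a) (H.measurable_eval W) hi

end IsSeSVC

/-- Sojourn times and recruitment durations are positive, and no two departures and completions
of recruitments, which are due to different departures, coincide. -/
structure Generic {V : Type*} (z u : V → ℝ) : Prop where
  pos_z : ∀ c, 0 < z c
  pos_u : ∀ c, 0 < u c
  z_ne_z : ∀ a b, a ≠ b → z a ≠ z b
  z_ne_zu : ∀ a b c, a ≠ b → z a ≠ z b + u c
  zu_ne_zu : ∀ a b c d, a ≠ b → z a + u c ≠ z b + u d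

/-- `R` may have atoms, so each coincidence is excluded by isolating one sojourn time, which is
atomless and independent of the rest. Countably many coincidences are involved. -/
theorem IsSeSVC.ae_generic {Ω V : Type*} [Countable V] [MeasurableSpace Ω] {μ : Measure Ω}
    [IsProbabilityMeasure μ] {Z U : V → Ω → ℝ} {lam : ℝ} {R : Measure ℝ}
    (H : IsSeSVC μ Z U lam R) (hR : R (Set.Iic 0) = 0) :
    ∀ᵐ ω ∂μ, Generic (fun c => Z c ω) (fun c => U c ω) := by
  have h1 := ae_all_iff.2 H.ae_pos_Z
  have h2 := ae_all_iff.2 (H.ae_pos_U hR)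
  have h3 : ∀ᵐ ω ∂μ, ∀ a b, a ≠ b → Z a ω ≠ Z b ω := by
    simp only [ae_all_iff]
    exact fun a b h => H.ae_Z_ne (W := .Z b) (by simpa [EVar.vars] using h)
  have h4 : ∀ᵐ ω ∂μ, ∀ a b c, a ≠ b → Z a ω ≠ Z b ω + U c ω := by
    simp only [ae_all_iff]
    exact fun a b c h => H.ae_Z_ne (W := .sum (.Z b) (.U c)) (by simpa [EVar.vars] using h)
  -- Moving one recruitment duration to the right leaves an expression free of `Z a`; the case `c =
  -- d` is harmless.
  have h5 : ∀ᵐ ω ∂μ, ∀ a b c d, a ≠ b → Z a ω ≠ Z b ω + U d ω - U c ω := by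
    simp only [ae_all_iff]
    exact fun a b c d h => H.ae_Z_ne (W := .diff (.sum (.Z b) (.U d)) (.U c))
      (by simpa [EVar.vars] using h)
  filter_upwards [h1, h2, h3, h4, h5] with ω h1 h2 h3 h4 h5
  exact ⟨h1, h2, h3, h4, fun a b c d h e => h5 a b c d h (eq_sub_of_add_eq e)⟩

/-! ### The lists of an H-state -/

/-- The vehicles which enter the lists of `S_{i,j}`: the vehicles processing the groups, the
recruiters together with those whose departures they make up for, and, if `j ≠ 0`, the recruiter
that has just completed its recruitment (second component of `clock`) together with the departed
vehicle that it made up for. -/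
structure Labels (V : Type*) (n i j : ℕ) where
  act : Fin (2 * n - i) → V
  orig : Fin i → V
  recr : Fin i → V
  clock : Fin (min j 1) → V × V

namespace Labels

variable {V : Type*} {n i j : ℕ}

/-- `Fin (min j 1)` has one point if `j ≠ 0` and is empty if `j = 0`: a clock is present exactly
when the last event was a recruitment. -/
theorem zero_lt_min_one {j : ℕ} (hj : ¬ j = 0) : 0 < min j 1 := by omega

theorem pred_lt_of_fin {i : ℕ} (k : Fin i) : i - 1 < i := by have := k.2; omega

/-- The departed vehicle of the completed recruitment. -/
def clockZ (L : Labels V n i j) (hj : ¬ j = 0) : V := (L.clock ⟨0, zero_lt_min_one hj⟩).1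

/-- The recruiter of the completed recruitment. -/
def clockU (L : Labels V n i j) (hj : ¬ j = 0) : V := (L.clock ⟨0, zero_lt_min_one hj⟩).2

/-- The lists of the H-state. -/
def desc (L : Labels V n i j) : HDesc V n i where
  vehicle := L.act
  recruiter := L.recr
  sojourn k :=
    if hj : j = 0 then
      if hi : i = 0 then .Z (L.act k)
      -- The origins are listed in the order of departure, so index `i - 1` is the departure that
      -- has just occurred.
      else .diff (.Z (L.act k)) (.Z (L.orig ⟨i - 1, Nat.sub_one_lt hi⟩))
    else .diff (.Z (L.act k)) (.sum (.Z (L.clockZ hj)) (.U (L.clockU hj)))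
  recruitment k :=
    if hj : j = 0 then
      if (k : ℕ) + 1 = i then .U (L.recr k)
      else .diff (.U (L.recr k))
        (.diff (.Z (L.orig ⟨i - 1, pred_lt_of_fin k⟩)) (.Z (L.orig k)))
    -- The first `j - 1` origins departed before the clock's departed vehicle, the others after it.
    -- The sign of this difference decides between γ and ψ.
    else if (k : ℕ) < j - 1 then
      .diff (.diff (.U (L.recr k)) (.diff (.Z (L.clockZ hj)) (.Z (L.orig k)))) (.U (L.clockU hj))
    else
      .diff (.U (L.recr k)) (.diff (.U (L.clockU hj)) (.diff (.Z (L.orig k)) (.Z (L.clockZ hj))))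

/-- The time at which the H-state is entered. -/
def time (L : Labels V n i j) (z u : V → ℝ) : ℝ :=
  if hj : j = 0 then
    if hi : i = 0 then 0 else z (L.orig ⟨i - 1, Nat.sub_one_lt hi⟩)
  else z (L.clockZ hj) + u (L.clockU hj)

theorem eval_sojourn (L : Labels V n i j) (z u : V → ℝ) (k : Fin (2 * n - i)) :
    (L.desc.sojourn k).eval z u = z (L.act k) - L.time z u := by
  simp only [desc, time]
  split_ifs <;> simp [EVar.eval]

theorem eval_recruitment (L : Labels V n i j) (z u : V → ℝ) (k : Fin i) :
    (L.desc.recruitment k).eval z u = z (L.orig k) + u (L.recr k) - L.time z u := by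
  have hi : ¬ i = 0 := by have := k.2; omega
  simp only [desc, time, hi, dite_false]
  split_ifs with hj h h
  -- For the newest recruiter the origin's departure is the current time itself and cancels.
  · have : (⟨i - 1, Nat.sub_one_lt hi⟩ : Fin i) = k := Fin.ext (by simp; omega)
    rw [this]
    simp [EVar.eval]
  all_goals simp only [EVar.eval]; ring

theorem isDiff_recruitment (L : Labels V n i j) (k : Fin i) :
    (L.desc.recruitment k).IsDiff ↔ ¬ (j = 0 ∧ (k : ℕ) + 1 = i) := by
  simp only [desc]
  split_ifs <;> simp_all [EVar.IsDiff]

theorem duration_recruitment (L : Labels V n i j) (k : Fin i) :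
    (L.desc.recruitment k).duration = .U (L.recr k) := by
  simp only [desc]
  split_ifs <;> simp [EVar.duration]

/-- Everything subtracted in the nested differences telescopes to the current time. All composite
entries thus share one reducer, as pivotal comparison requires. -/
theorem reducer_recruitment (L : Labels V n i j) (z u : V → ℝ) (k : Fin i)
    (h : (L.desc.recruitment k).IsDiff) :
    (L.desc.recruitment k).reducer z u = L.time z u := by
  have hi : ¬ i = 0 := by have := k.2; omega
  rw [isDiff_recruitment] at h
  simp only [desc, time, hi, dite_false]
  split_ifs with hj h1 h1
  · exact absurd ⟨hj, h1⟩ h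
  all_goals simp only [EVar.eval, EVar.reducer]; ring

/-- Adding the time back and removing the duration leaves the departure that started the
recruitment; pivotal order is departure order. -/
theorem pivot_recruitment (L : Labels V n i j) (z u : V → ℝ) (k : Fin i)
    (h : (L.desc.recruitment k).IsDiff) :
    (L.desc.recruitment k).pivot z u = z (L.orig k) := by
  rw [EVar.pivot, eval_recruitment, reducer_recruitment L z u k h, duration_recruitment, EVar.eval]
  ring

theorem pivLE_recruitment_iff (L : Labels V n i j) (z u : V → ℝ) (k l : Fin i) :
    EVar.PivLE z u (L.desc.recruitment k) (L.desc.recruitment l) ↔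
      ¬ (j = 0 ∧ (k : ℕ) + 1 = i) ∧ ((j = 0 ∧ (l : ℕ) + 1 = i) ∨
        (L.recr k ≠ L.recr l ∧ z (L.orig k) ≤ z (L.orig l))) := by
  rw [EVar.PivLE, duration_recruitment, duration_recruitment, ne_eq, EVar.U.injEq]
  by_cases hk : (L.desc.recruitment k).IsDiff
  · by_cases hl : (L.desc.recruitment l).IsDiff
    · rw [pivot_recruitment _ _ _ _ hk, pivot_recruitment _ _ _ _ hl,
        reducer_recruitment _ _ _ _ hk, reducer_recruitment _ _ _ _ hl]
      rw [← isDiff_recruitment L k]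
      have := (isDiff_recruitment L l).1 hl
      tauto
    · have h1 := (isDiff_recruitment L k)
      have h2 := (isDiff_recruitment L l)
      tauto
  · have h1 := (isDiff_recruitment L k)
    tauto

/-- The vehicles are distinct. -/
structure Distinct (L : Labels V n i j) : Prop where
  z_inj : Function.Injective (Sum.elim L.act (Sum.elim L.orig fun k => (L.clock k).1))
  u_inj : Function.Injective (Sum.elim L.recr fun k => (L.clock k).2)

/-- The conditions on the outcome under which the lists of the H-state describe the system. -/
structure Admissible (L : Labels V n i j) (z u : V → ℝ) : Prop where
  pos_z : ∀ c, 0 < z c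
  pos_u : ∀ c, 0 < u c
  time_lt_act : ∀ k, L.time z u < z (L.act k)
  time_lt_recr : ∀ k, L.time z u < z (L.orig k) + u (L.recr k)
  orig_lt : ∀ k l, k < l → z (L.orig k) < z (L.orig l)
  orig_lt_clock : ∀ (hj : ¬ j = 0) (k : Fin i), (k : ℕ) < j - 1 → z (L.orig k) < z (L.clockZ hj)
  clock_lt_orig : ∀ (hj : ¬ j = 0) (k : Fin i), ¬ (k : ℕ) < j - 1 → z (L.clockZ hj) < z (L.orig k)
  orig_lt_time : ¬ j = 0 → ∀ k, z (L.orig k) < L.time z u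

/-! ### Admissible outcomes satisfy the conditions on the lists -/

section Distinct

variable {L : Labels V n i j} (hL : L.Distinct)

include hL

theorem Distinct.recr_inj : Function.Injective L.recr :=
  fun k l h => Sum.inl_injective (hL.u_inj (a₁ := Sum.inl k) (a₂ := Sum.inl l) h)

theorem Distinct.act_inj : Function.Injective L.act :=
  fun k l h => Sum.inl_injective (hL.z_inj (a₁ := Sum.inl k) (a₂ := Sum.inl l) h)

theorem Distinct.orig_inj : Function.Injective L.orig := fun k l h =>
  Sum.inl_injective (Sum.inr_injective
    (hL.z_inj (a₁ := Sum.inr (Sum.inl k)) (a₂ := Sum.inr (Sum.inl l)) h))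

theorem Distinct.act_ne_orig (k : Fin (2 * n - i)) (l : Fin i) : L.act k ≠ L.orig l := fun h => by
  cases hL.z_inj (a₁ := Sum.inl k) (a₂ := Sum.inr (Sum.inl l)) h

theorem Distinct.act_ne_clock (k : Fin (2 * n - i)) (hj : ¬ j = 0) : L.act k ≠ L.clockZ hj :=
  fun h => by cases hL.z_inj (a₁ := Sum.inl k) (a₂ := Sum.inr (Sum.inr _)) h

theorem Distinct.orig_ne_clock (k : Fin i) (hj : ¬ j = 0) : L.orig k ≠ L.clockZ hj :=
  fun h => by cases hL.z_inj (a₁ := Sum.inr (Sum.inl k)) (a₂ := Sum.inr (Sum.inr _)) h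

theorem Distinct.recr_ne_clock (k : Fin i) (hj : ¬ j = 0) : L.recr k ≠ L.clockU hj :=
  fun h => by cases hL.u_inj (a₁ := Sum.inl k) (a₂ := Sum.inr _) h

theorem Admissible.pivLE_iff {z u : V → ℝ} (h : L.Admissible z u) (k l : Fin i) :
    EVar.PivLE z u (L.desc.recruitment k) (L.desc.recruitment l) ↔ k < l := by
  rw [pivLE_recruitment_iff]
  have hk := k.2
  have hl := l.2
  constructor
  · rintro ⟨h1, h2 | ⟨h2, h3⟩⟩
    · rw [Fin.lt_def]
      omega
    · by_contra h4
      rcases (not_lt.1 h4).lt_or_eq with h5 | h5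
      · exact absurd (h.orig_lt l k h5) (not_lt.2 h3)
      · exact h2 (congrArg _ h5.symm)
  · intro hkl
    refine ⟨?_, Or.inr ⟨fun e => hkl.ne (hL.recr_inj e), (h.orig_lt k l hkl).le⟩⟩
    rw [Fin.lt_def] at hkl
    omega

omit hL in
theorem Admissible.isEDVAt_sojourn {z u : V → ℝ} (h : L.Admissible z u) (k : Fin (2 * n - i)) :
    (L.desc.sojourn k).IsEDVAt z u := by
  have h1 := h.time_lt_act k
  have h2 := h.pos_z
  have h3 := h.pos_u
  simp only [desc]
  simp only [time] at h1
  split_ifs <;> simp_all [EVar.IsEDVAt, EVar.eval]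

omit hL in
theorem Admissible.isEDVAt_recruitment {z u : V → ℝ} (h : L.Admissible z u) (k : Fin i) :
    (L.desc.recruitment k).IsEDVAt z u := by
  have hi : ¬ i = 0 := by have := k.2; omega
  have h1 := h.time_lt_recr k
  have h2 := h.pos_z
  have h3 := h.pos_u
  have h4 := h.orig_lt_time
  simp only [desc]
  simp only [time] at h1 h4
  split_ifs with hj hk hk
  · simp [EVar.IsEDVAt, h3]
  · have h5 := h.orig_lt k ⟨i - 1, pred_lt_of_fin k⟩ (by rw [Fin.lt_def]; simp; omega)
    simp only [hj, hi, dite_true, dite_false] at h1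
    simp only [EVar.IsEDVAt, EVar.eval, h2, h3, true_and]
    constructor <;> linarith
  -- Both γ inequalities come from `Z_b + U_l < Z_a + U_k`; the inner one drops `U_l > 0`.
  · have h5 := h.orig_lt_clock hj k hk
    have h6 := h3 (L.clockU hj)
    simp only [hj, dite_false] at h1
    simp only [EVar.IsEDVAt, EVar.eval, h2, h3, true_and]
    refine ⟨⟨?_, ?_⟩, ?_⟩ <;> linarith
  -- In the ψ case `U_l > Z_a - Z_b` says that the origin departed before the current time.
  · have h5 := h.clock_lt_orig hj k hk
    have h6 := h4 hj k
    simp only [hj, dite_false] at h1 h6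
    simp only [EVar.IsEDVAt, EVar.eval, h2, h3, true_and]
    refine ⟨⟨?_, ?_⟩, ?_⟩ <;> linarith

theorem Admissible.relations {z u : V → ℝ} (h : L.Admissible z u) : L.desc.Relations z u :=
  ⟨h.isEDVAt_sojourn, h.isEDVAt_recruitment, fun k l hkl => (h.pivLE_iff hL k l).2 hkl⟩

theorem Admissible.order_eq {z u : V → ℝ} (h : L.Admissible z u) (k : Fin i) :
    L.desc.order z u k = k + 1 := by
  rw [HDesc.order]
  have : {l : Fin i | l ≠ k ∧ EVar.PivLE z u (L.desc.recruitment l) (L.desc.recruitment k)} =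
      (Finset.Iio k : Finset (Fin i)) := by
    ext l
    simp only [h.pivLE_iff hL, Set.mem_ofPred_eq, Finset.coe_Iio, Set.mem_Iio, and_iff_right_iff_imp]
    exact fun e => e.ne
  rw [this, Set.ncard_coe_finset, Fin.card_Iio]

/-- All reducers equal the current time and all pivots vanish, so these lists are increasing in
whatever order the vehicles are listed. -/
theorem pivLE_sojourn (h0 : ¬ (i = 0 ∧ j = 0)) (z u : V → ℝ) (k l : Fin (2 * n - i)) (hkl : k ≠ l) :
    EVar.PivLE z u (L.desc.sojourn k) (L.desc.sojourn l) := by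
  have e : L.act k ≠ L.act l := fun h => hkl (hL.act_inj h)
  right
  simp only [desc]
  split_ifs with hj hi
  · exact absurd ⟨hi, hj⟩ h0
  · simp [EVar.IsDiff, EVar.duration, EVar.reducer, EVar.pivot, EVar.eval, e]
  · simp [EVar.IsDiff, EVar.duration, EVar.reducer, EVar.pivot, EVar.eval, e]

theorem isHState {Ω : Type*} [MeasurableSpace Ω] {μ : Measure Ω} [IsProbabilityMeasure μ]
    {Z U : V → Ω → ℝ} {lam : ℝ} {R : Measure ℝ} (H : IsSeSVC μ Z U lam R)
    (hR : R (Set.Iic 0) = 0) (hji : j - 1 ≤ i) {ω : Ω}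
    (h : L.Admissible (fun c => Z c ω) (fun c => U c ω)) :
    L.desc.IsHState μ Z U lam R ω j := by
  have hp := fun h0 k l (hkl : k < l) => pivLE_sojourn hL h0 (fun c => Z c ω) (fun c => U c ω)
    k l hkl.ne
  have hq := (h.relations hL).2.2
  rw [HDesc.IsHState]
  split_ifs with hj hi
  · intro k
    simp [desc, hj, hi]
  · refine ⟨⟨fun k => ⟨h.isEDVAt_sojourn k, ?_⟩, hp (by tauto)⟩, by omega,
      h.isEDVAt_recruitment, fun k hk => ?_, fun k hk => ?_, hq⟩
    · simp only [desc, hj, hi, dite_true, dite_false]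
      exact H.follows_expDot (hL.act_ne_orig _ _)
    · have hk' : ¬ (k : ℕ) + 1 = i := by omega
      simp only [desc, hj, hk', dite_true, if_false]
      refine H.follows_phi hR _ fun e => hk' ?_
      have := congrArg Fin.val (hL.orig_inj e)
      simp only at this
      omega
    · have hk' : (k : ℕ) + 1 = i := by have := k.2; omega
      simp only [desc, hj, hk', dite_true, if_true]
      exact H.follows_recr hR _
  · refine ⟨⟨fun k => ⟨h.isEDVAt_sojourn k, ?_⟩, hp (by tauto)⟩, by omega,
      h.isEDVAt_recruitment, fun k hk => ?_, fun k hk => ?_, hq⟩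
    · simp only [desc, hj, dite_false]
      exact H.follows_expDDot hR (hL.act_ne_clock _ _) _
    · simp only [desc, hj, hk, dite_false, if_true]
      exact H.follows_gamma hR (hL.recr_ne_clock _ _) (hL.orig_ne_clock _ _).symm
    · simp only [desc, hj, not_lt.2 hk, dite_false, if_false]
      exact H.follows_psi hR (hL.recr_ne_clock _ _) (hL.orig_ne_clock _ _)

end Distinct

/-! ### The joint law of the lists -/

/-- The labels matter only through the values of the labelled variables and, in the condition that
durations differ, through their distinctness. -/
theorem relations_iff {V' : Type*} {L : Labels V n i j} {L' : Labels V' n i j} (hL : L.Distinct)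
    (hL' : L'.Distinct) {z u : V → ℝ} {z' u' : V' → ℝ} (ha : ∀ k, z' (L'.act k) = z (L.act k))
    (ho : ∀ k, z' (L'.orig k) = z (L.orig k)) (hr : ∀ k, u' (L'.recr k) = u (L.recr k))
    (hc : ∀ hj, z' (L'.clockZ hj) = z (L.clockZ hj))
    (hd : ∀ hj, u' (L'.clockU hj) = u (L.clockU hj)) :
    (L'.desc.Relations z' u' ↔ L.desc.Relations z u) ∧
      L'.desc.values z' u' = L.desc.values z u := by
  have ht : L'.time z' u' = L.time z u := by
    simp only [time, ho, hc, hd]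
  refine ⟨?_, ?_⟩
  · refine and_congr (forall_congr' fun k => ?_) (and_congr (forall_congr' fun k => ?_)
      (forall_congr' fun k => forall_congr' fun l => ?_))
    · simp only [desc]
      split_ifs <;> simp only [EVar.IsEDVAt, EVar.eval, ha, ho, hc, hd]
    · simp only [desc]
      split_ifs <;> simp only [EVar.IsEDVAt, EVar.eval, hr, ho, hc, hd]
    · rw [pivLE_recruitment_iff, pivLE_recruitment_iff, ho, ho, ne_eq, ne_eq,
        hL.recr_inj.eq_iff, hL'.recr_inj.eq_iff]
  · simp only [HDesc.values, eval_sojourn, eval_recruitment, ha, ho, hr, ht]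

end Labels

/-- Indices of the sojourn times which enter the lists of `S_{i,j}`. -/
abbrev SojournIndex (n i j : ℕ) : Type := Fin (2 * n - i) ⊕ Fin i ⊕ Fin (min j 1)

/-- Indices of the recruitment durations which enter the lists of `S_{i,j}`. -/
abbrev RecruitIndex (i j : ℕ) : Type := Fin i ⊕ Fin (min j 1)

/-- The lists of `S_{i,j}` in terms of coordinates. -/
def Labels.canonical (n i j : ℕ) : Labels (SojournIndex n i j ⊕ RecruitIndex i j) n i j where
  act k := .inl (.inl k)
  orig k := .inl (.inr (.inl k))
  recr k := .inr (.inl k)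
  clock k := (.inl (.inr (.inr k)), .inr (.inr k))

theorem Labels.distinct_canonical (n i j : ℕ) : (Labels.canonical n i j).Distinct := by
  constructor
  · rintro (a | a | a) (b | b | b) h <;> simp_all [canonical]
  · rintro (a | a) (b | b) h <;> simp_all [canonical]

/-- Independent sojourn times and recruitment durations. -/
noncomputable def coordLaw (lam : ℝ) (R : Measure ℝ) (A B : Type*) [Fintype A] [Fintype B] :
    Measure (A ⊕ B → ℝ) :=
  Measure.pi (Sum.elim (fun _ : A => expMeasure lam) (fun _ : B => R))

/-- The joint law of the lists of `S_{i,j}`. -/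
noncomputable def hLaw (n : ℕ) (lam : ℝ) (R : Measure ℝ) (i j : ℕ) : Measure (Residuals n i) :=
  (Labels.canonical n i j).desc.jointLaw (coordLaw lam R (SojournIndex n i j) (RecruitIndex i j))
    (fun c p => p c) (fun c p => p c)

theorem measurable_values {Ω V : Type*} [MeasurableSpace Ω] {Z U : V → Ω → ℝ} {n i : ℕ}
    (hm : ∀ x, Measurable (Sum.elim Z U x)) (d : HDesc V n i) :
    Measurable (fun ω => d.values (fun c => Z c ω) (fun c => U c ω)) :=
  (measurable_pi_lambda _ fun k => (d.sojourn k).measurable_eval_of fun x _ => hm x).prodMk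
    (measurable_pi_lambda _ fun k => (d.recruitment k).measurable_eval_of fun x _ => hm x)

theorem measurableSet_relations {Ω V : Type*} [MeasurableSpace Ω] {Z U : V → Ω → ℝ} {n i j : ℕ}
    (hm : ∀ x, Measurable (Sum.elim Z U x)) (L : Labels V n i j) :
    MeasurableSet {ω | L.desc.Relations (fun c => Z c ω) (fun c => U c ω)} := by
  have h1 := MeasurableSet.iInter fun k => (L.desc.sojourn k).measurableSet_isEDVAt_of
    (Z := Z) (U := U) fun x _ => hm x
  have h2 := MeasurableSet.iInter fun k => (L.desc.recruitment k).measurableSet_isEDVAt_of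
    (Z := Z) (U := U) fun x _ => hm x
  have h3 : MeasurableSet (⋂ k, ⋂ l, {ω | k < l → EVar.PivLE (fun c => Z c ω) (fun c => U c ω)
      (L.desc.recruitment k) (L.desc.recruitment l)}) := by
    refine MeasurableSet.iInter fun k => MeasurableSet.iInter fun l => ?_
    simp only [Labels.pivLE_recruitment_iff]
    have := measurableSet_le (hm (Sum.inl (L.orig k))) (hm (Sum.inl (L.orig l)))
    simp only [Sum.elim_inl] at this
    measurability
  convert h1.inter (h2.inter h3)
  ext ω
  simp [HDesc.Relations]

/-- Relations and values factor through the coordinate map `Φ`, whose law is a product that does not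
see which variables were chosen. -/
theorem Labels.jointLaw_eq {Ω V : Type*} [MeasurableSpace Ω] {μ : Measure Ω}
    [IsProbabilityMeasure μ] {Z U : V → Ω → ℝ} {lam : ℝ} {R : Measure ℝ}
    (H : IsSeSVC μ Z U lam R) {n i j : ℕ} {L : Labels V n i j} (hL : L.Distinct) :
    L.desc.jointLaw μ Z U = hLaw n lam R i j := by
  let f := Sum.elim L.act (Sum.elim L.orig fun k => (L.clock k).1)
  let g := Sum.elim L.recr fun k => (L.clock k).2
  let Φ : Ω → (SojournIndex n i j ⊕ RecruitIndex i j → ℝ) :=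
    fun ω x => Sum.elim Z U (Sum.map f g x) ω
  have hΦ : Measurable Φ := measurable_pi_lambda _ fun x => H.measurable_elim _
  have hlaw : μ.map Φ = coordLaw lam R _ _ := by
    -- Distinct labels select each variable at most once, so the reindexed family remains
    -- independent.
    have hi := H.indep.precomp (Sum.map_injective.2 ⟨hL.z_inj, hL.u_inj⟩)
    rw [(iIndepFun_iff_map_fun_eq_pi_map fun x => (H.measurable_elim _).aemeasurable).1 hi, coordLaw]
    congr 1
    ext1 x
    cases x with
    | inl a => exact H.law_Z _
    | inr b => exact H.law_U _
  have hm : ∀ x, Measurable (Sum.elim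
      (fun c (p : SojournIndex n i j ⊕ RecruitIndex i j → ℝ) => p c) (fun c p => p c) x) := by
    rintro (x | x) <;> exact measurable_pi_apply x
  have hrel : ∀ ω, _ := fun ω => Labels.relations_iff (distinct_canonical n i j) hL
    (z' := fun c => Z c ω) (u' := fun c => U c ω) (z := Φ ω) (u := Φ ω)
    (fun _ => rfl) (fun _ => rfl) (fun _ => rfl) (fun _ => rfl) (fun _ => rfl)
  rw [hLaw, HDesc.jointLaw, HDesc.jointLaw, ← hlaw,
    ← map_cond_preimage hΦ (measurableSet_relations hm _),
    Measure.map_map (measurable_values hm _) hΦ]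
  congr 1
  · funext ω
    exact (hrel ω).2
  · congr 1
    ext ω
    exact (hrel ω).1

/-! ### Symbolic configurations -/

/-- The configuration and its past in terms of vehicles only.  The recruiting groups are listed in
`queue`, in the order of the departures they suffered; such a group `g` is processed by `w₁ g` and
has been left by `w₂ g`, while the groups outside of `queue` are processed by `w₁ g` and `w₂ g`.
If the last event is a recruitment, `clock` consists of the departed vehicle that has been made up
for and of the recruiter, which had order `j`; otherwise `j = 0`. -/
structure SymConfig (V : Type*) (n : ℕ) where
  w₁ : Fin n → V
  w₂ : Fin n → V
  queue : List (Fin n)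
  j : ℕ
  clock : V × V

namespace SymConfig

variable {V : Type*} {n : ℕ}

/-- The symbolic counterpart of a transition. -/
inductive SymStep (S : SymConfig V n) : Move V → SymConfig V n → Prop where
  | depart {g : Fin n} {c d : V} (hg : g ∉ S.queue)
      (h : (S.w₁ g = c ∧ S.w₂ g = d) ∨ (S.w₁ g = d ∧ S.w₂ g = c)) :
      SymStep S (.depart c) ⟨Function.update S.w₁ g d, Function.update S.w₂ g c,
        S.queue ++ [g], 0, S.clock⟩
  | recruit {g : Fin n} {c y : V} (hg : g ∈ S.queue) (h : S.w₁ g = c) :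
      SymStep S (.recruit c y) ⟨S.w₁, Function.update S.w₂ g y,
        S.queue.erase g, S.queue.idxOf g + 1, (S.w₂ g, c)⟩

/-- The symbolic configuration after a history. -/
noncomputable def after (S : SymConfig V n) (h : List (Move V)) : SymConfig V n :=
  open Classical in
  -- Moves without a symbolic step are ignored. This default is never met along a run with positive
  -- times.
  h.foldl (fun S m => if e : ∃ S', SymStep S m S' then e.choose else S) S

theorem symStep_after (S : SymConfig V n) (h : List (Move V)) (m : Move V) {S' : SymConfig V n}
    (hS : SymStep (S.after h) m S') : SymStep (S.after h) m (S.after (h ++ [m])) := by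
  have e : ∃ S', SymStep (S.after h) m S' := ⟨S', hS⟩
  have : S.after (h ++ [m]) = e.choose := by
    rw [after, List.foldl_append]
    exact dif_pos e
  rw [this]
  exact e.choose_spec

/-- The groups, the recruiting ones coming first. -/
def order (S : SymConfig V n) : List (Fin n) :=
  S.queue ++ (List.finRange n).filter (fun g => g ∉ S.queue)

/-- The `k`-th group. -/
def nth (S : SymConfig V n) (k : Fin n) : Fin n := S.order.getD k k

/-- The vehicles of the lists of the H-state. -/
def labels (S : SymConfig V n) : Labels V n S.queue.length S.j where
  -- The first `n` places hold one vehicle of each group, recruiters first; the remaining `n - i`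
  -- hold the second vehicles of the groups behind the queue.
  act k := if h : (k : ℕ) < n then S.w₁ (S.nth ⟨k, h⟩)
    else S.w₂ (S.nth ⟨S.queue.length + (k - n), by omega⟩)
  orig k := S.w₂ (S.queue.get k)
  recr k := S.w₁ (S.queue.get k)
  clock _ := S.clock

section Nth

variable {S : SymConfig V n} (hq : S.queue.Nodup)

include hq

theorem nodup_order : S.order.Nodup := by
  refine List.Nodup.append hq ((List.nodup_finRange n).filter _) ?_
  intro g h1 h2
  simp_all

omit hq in
theorem mem_order (g : Fin n) : g ∈ S.order := by
  by_cases h : g ∈ S.queue <;> simp [order, h]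

theorem length_order : S.order.length = n := by
  have h1 : S.order.toFinset = Finset.univ := by
    ext g
    simp [mem_order]
  rw [← List.toFinset_card_of_nodup (nodup_order hq), h1, Finset.card_fin]

/-- The order has exactly `n` entries, so the default value in `nth` is never used. -/
theorem nth_eq (k : Fin n) :
    S.nth k = S.order[(k : ℕ)]'(by rw [length_order hq]; exact k.2) := by
  rw [nth, List.getD_eq_getElem]

theorem nth_bijective : Function.Bijective S.nth := by
  refine Finite.injective_iff_bijective.1 fun k l h => ?_
  rw [nth_eq hq, nth_eq hq, (nodup_order hq).getElem_inj_iff] at h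
  exact Fin.ext h

theorem length_queue_le : S.queue.length ≤ n := by
  have := hq.length_le_card
  rwa [Fintype.card_fin] at this

theorem nth_of_lt (k : Fin n) (hk : (k : ℕ) < S.queue.length) : S.nth k = S.queue[(k : ℕ)] := by
  rw [nth_eq hq]
  simp only [order]
  rw [List.getElem_append_left hk]

theorem nth_mem_queue (k : Fin n) : S.nth k ∈ S.queue ↔ (k : ℕ) < S.queue.length := by
  constructor
  · intro h
    obtain ⟨l, hl, e⟩ := List.getElem_of_mem h
    have hn := length_queue_le hq
    have : S.nth ⟨l, by omega⟩ = S.nth k := by rw [nth_of_lt hq _ hl, e]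
    rw [← (nth_bijective hq).1 this]
    exact hl
  · intro h
    rw [nth_of_lt hq k h]
    exact List.getElem_mem _

end Nth

/-- For the outcome `(z, u)`, the symbolic configuration corresponds to `X`. -/
structure Matches (z u : V → ℝ) (S : SymConfig V n) (X : VCConfig V n) : Prop where
  status_single : ∀ g ∈ S.queue, X.status g = .single (S.w₁ g) (z (S.w₂ g))
  status_pair : ∀ g ∉ S.queue,
    X.status g = .pair (S.w₁ g) (S.w₂ g) ∨ X.status g = .pair (S.w₂ g) (S.w₁ g)
  inj₁ : Function.Injective S.w₁
  inj₂ : Function.Injective S.w₂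
  ne : ∀ g g', S.w₁ g ≠ S.w₂ g'
  nodup : S.queue.Nodup
  sorted : S.queue.Pairwise (fun g g' => z (S.w₂ g) < z (S.w₂ g'))
  time_eq : X.time = S.labels.time z u
  time_lt₁ : ∀ g, X.time < z (S.w₁ g)
  time_lt₂ : ∀ g ∉ S.queue, X.time < z (S.w₂ g)
  le_time : ∀ g ∈ S.queue, z (S.w₂ g) ≤ X.time
  time_lt_recr : ∀ g ∈ S.queue, X.time < z (S.w₂ g) + u (S.w₁ g)
  clock_ne : S.j ≠ 0 → ∀ g ∈ S.queue, S.w₁ g ≠ S.clock.2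
  lt_clock : S.j ≠ 0 → ∀ g ∈ S.queue.take (S.j - 1), z (S.w₂ g) < z S.clock.1
  clock_lt : S.j ≠ 0 → ∀ g ∈ S.queue.drop (S.j - 1), z S.clock.1 < z (S.w₂ g)
  lt_time : S.j ≠ 0 → ∀ g ∈ S.queue, z (S.w₂ g) < X.time
  j_le : S.j - 1 ≤ S.queue.length
  queue_lt : S.j ≠ 0 → S.queue.length < n

/-! ### The invariant: its consequences and its preservation -/

namespace Matches

variable {z u : V → ℝ} {S : SymConfig V n} {X : VCConfig V n}

theorem active_iff (h : S.Matches z u X) (c : V) :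
    X.Active c ↔ ∃ g, c = S.w₁ g ∨ (g ∉ S.queue ∧ c = S.w₂ g) := by
  refine exists_congr fun g => ?_
  by_cases hg : g ∈ S.queue
  · simp [h.status_single g hg, hg, GroupStatus.Has]
  · rcases h.status_pair g hg with e | e <;> simp [e, hg, GroupStatus.Has, or_comm]

theorem single_iff (h : S.Matches z u X) (g : Fin n) (c : V) (s : ℝ) :
    X.status g = .single c s ↔ g ∈ S.queue ∧ c = S.w₁ g ∧ s = z (S.w₂ g) := by
  by_cases hg : g ∈ S.queue
  · simp [h.status_single g hg, hg, eq_comm]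
  · rcases h.status_pair g hg with e | e <;> simp [e, hg]

theorem of_pair (h : S.Matches z u X) {g : Fin n} {c d : V} (e : X.status g = .pair c d) :
    g ∉ S.queue ∧ ((S.w₁ g = c ∧ S.w₂ g = d) ∨ (S.w₁ g = d ∧ S.w₂ g = c)) := by
  by_cases hg : g ∈ S.queue
  · simp [h.status_single g hg] at e
  · refine ⟨hg, ?_⟩
    rcases h.status_pair g hg with e' | e' <;> rw [e'] at e <;> simp_all

/-- Times separate the vehicles: the clock's departed vehicle left before the current time, vehicles
still present leave after it, and the queued departures lie strictly before or after that of the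
clock. -/
theorem distinct (h : S.Matches z u X) (hu : ∀ c, 0 < u c) : S.labels.Distinct := by
  have hq := h.nodup
  have hn := (nth_bijective hq).1
  have hclock : S.j ≠ 0 → z S.clock.1 < X.time := by
    intro hj
    rw [h.time_eq, Labels.time, dif_neg hj]
    exact lt_add_of_pos_right _ (hu _)
  have hc1 : S.j ≠ 0 → ∀ g, S.w₁ g ≠ S.clock.1 := fun hj g e => by
    have := h.time_lt₁ g
    rw [e] at this
    exact lt_asymm this (hclock hj)
  have hc2 : S.j ≠ 0 → ∀ g, S.w₂ g ≠ S.clock.1 := fun hj g e => by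
    by_cases hg : g ∈ S.queue
    · rw [← List.take_append_drop (S.j - 1) S.queue, List.mem_append] at hg
      rcases hg with hg | hg
      · exact (h.lt_clock hj g hg).ne (by rw [e])
      · exact (h.clock_lt hj g hg).ne (by rw [e])
    · have := h.time_lt₂ g hg
      rw [e] at this
      exact lt_asymm this (hclock hj)
  have hj' : Fin (min S.j 1) → S.j ≠ 0 := fun k => by have := k.2; omega
  have hsub : ∀ a b : Fin (min S.j 1), a = b := fun a b => by
    have := a.2
    have := b.2
    exact Fin.ext (by omega)
  constructor
  · rintro (a | a | a) (b | b | b) e <;>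
      simp only [labels, Sum.elim_inl, Sum.elim_inr] at e
    · congr 1
      split_ifs at e with h1 h2 h2
      · have := hn (h.inj₁ e)
        simp only [Fin.mk.injEq] at this
        exact Fin.ext this
      · exact absurd e (h.ne _ _)
      · exact absurd e.symm (h.ne _ _)
      · have := hn (h.inj₂ e)
        simp only [Fin.mk.injEq] at this
        exact Fin.ext (by omega)
    · split_ifs at e with h1
      · exact absurd e (h.ne _ _)
      · have h2 := h.inj₂ e
        have h3 := (nth_mem_queue hq _).1 (h2 ▸ List.get_mem _ _)
        simp at h3
    · split_ifs at e
      · exact absurd e (hc1 (hj' b) _)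
      · exact absurd e (hc2 (hj' b) _)
    · split_ifs at e with h1
      · exact absurd e.symm (h.ne _ _)
      · have h2 := h.inj₂ e
        have h3 := (nth_mem_queue hq _).1 (h2 ▸ List.get_mem _ _)
        simp at h3
    · rw [List.nodup_iff_injective_get.1 hq (h.inj₂ e)]
    · exact absurd e (hc2 (hj' b) _)
    · split_ifs at e
      · exact absurd e.symm (hc1 (hj' a) _)
      · exact absurd e.symm (hc2 (hj' a) _)
    · exact absurd e.symm (hc2 (hj' a) _)
    · rw [hsub a b]
  · rintro (a | a) (b | b) e <;> simp only [labels, Sum.elim_inl, Sum.elim_inr] at e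
    · rw [List.nodup_iff_injective_get.1 hq (h.inj₁ e)]
    · exact absurd e (h.clock_ne (hj' b) _ (List.get_mem _ _))
    · exact absurd e.symm (h.clock_ne (hj' a) _ (List.get_mem _ _))
    · rw [hsub a b]

theorem admissible (h : S.Matches z u X) (hz : ∀ c, 0 < z c) (hu : ∀ c, 0 < u c) :
    S.labels.Admissible z u where
  pos_z := hz
  pos_u := hu
  time_lt_act k := by
    rw [← h.time_eq]
    simp only [labels]
    split_ifs with h1
    · exact h.time_lt₁ _
    · refine h.time_lt₂ _ fun h2 => ?_
      have := (nth_mem_queue h.nodup _).1 h2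
      simp at this
  time_lt_recr k := by
    rw [← h.time_eq]
    exact h.time_lt_recr _ (List.get_mem _ _)
  orig_lt k l hkl := List.pairwise_iff_get.1 h.sorted k l hkl
  orig_lt_clock hj k hk := h.lt_clock hj _ (by
    rw [List.mem_take_iff_getElem]
    exact ⟨k, by simp [hk], rfl⟩)
  clock_lt_orig hj k hk := h.clock_lt hj _ (by
    rw [List.mem_drop_iff_getElem]
    exact ⟨k - (S.j - 1), by have := k.2; omega, by simp [Nat.add_sub_cancel' (not_lt.1 hk)]⟩)
  orig_lt_time hj k := by
    rw [← h.time_eq]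
    exact h.lt_time hj _ (List.get_mem _ _)

theorem level_eq (h : S.Matches z u X) : X.level = S.queue.length := by
  rw [VCConfig.level, ← List.toFinset_card_of_nodup h.nodup]
  congr 1
  ext g
  rw [Finset.mem_filter, List.mem_toFinset]
  by_cases hg : g ∈ S.queue
  · simp [h.status_single g hg, hg, GroupStatus.isSingle]
  · rcases h.status_pair g hg with e | e <;> simp [e, hg, GroupStatus.isSingle]

theorem mem_hStates (h : S.Matches z u X) : (S.queue.length, S.j) ∈ hStates n S.queue.length := by
  have h1 := length_queue_le h.nodup
  have h2 := h.queue_lt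
  have h3 := h.j_le
  rw [hStates]
  split_ifs with h4
  · simp; omega
  · simp; omega

theorem describes (h : S.Matches z u X) (hu : ∀ c, 0 < u c) :
    S.labels.desc.Describes z u X where
  vehicle_inj := (h.distinct hu).act_inj
  vehicle_iff c := by
    rw [h.active_iff]
    constructor
    · rintro ⟨g, hg⟩
      obtain ⟨p, rfl⟩ := (nth_bijective h.nodup).2 g
      have hp := p.2
      have hl := length_queue_le h.nodup
      rw [nth_mem_queue h.nodup] at hg
      rcases hg with rfl | ⟨hg, rfl⟩
      · by_cases h1 : (p : ℕ) < 2 * n - S.queue.length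
        · exact ⟨⟨p, h1⟩, by simp [Labels.desc, labels]⟩
        · omega
      · refine ⟨⟨n + (p - S.queue.length), by omega⟩, ?_⟩
        simp [Labels.desc, labels, Nat.add_sub_cancel' (not_lt.1 hg)]
    · rintro ⟨k, rfl⟩
      simp only [Labels.desc, labels]
      split_ifs with h1
      · exact ⟨_, Or.inl rfl⟩
      · refine ⟨_, Or.inr ⟨?_, rfl⟩⟩
        rw [nth_mem_queue h.nodup]
        simp
  sojourn_eq k := by
    rw [Labels.eval_sojourn, h.time_eq]
    rfl
  recruiter_inj := (h.distinct hu).recr_inj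
  recruiter_iff c := by
    simp only [h.single_iff]
    constructor
    · rintro ⟨g, s, hg, rfl, rfl⟩
      obtain ⟨k, rfl⟩ := List.get_of_mem hg
      exact ⟨k, rfl⟩
    · rintro ⟨k, rfl⟩
      exact ⟨_, _, List.get_mem _ k, rfl, rfl⟩
  recruitment_eq k g s hg := by
    obtain ⟨h1, h2, rfl⟩ := (h.single_iff _ _ _).1 hg
    rw [Labels.eval_recruitment, h.time_eq]
    rw [← h.inj₁ h2]
    rfl
  recruiter_first k l hkl := by
    have h1 := length_queue_le h.nodup
    have h2 := l.2
    have h3 : (k : ℕ) < n := by omega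
    simp only [Labels.desc, labels, h3, dite_true]
    rw [nth_of_lt h.nodup _ (by simp [hkl])]
    simp [hkl]

theorem next_lt (h : S.Matches z u X) {e : VCEvent V} {t : ℝ} (hn : IsNext z u X e t) :
    (∀ g, e ≠ .depart (S.w₁ g) → t < z (S.w₁ g)) ∧
    (∀ g ∉ S.queue, e ≠ .depart (S.w₂ g) → t < z (S.w₂ g)) ∧
    (∀ g ∈ S.queue, e ≠ .recruit (S.w₁ g) → t < z (S.w₂ g) + u (S.w₁ g)) :=
  ⟨fun g he => hn.2 _ _ (.depart ((h.active_iff _).2 ⟨g, Or.inl rfl⟩)) he.symm,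
    fun g hg he => hn.2 _ _ (.depart ((h.active_iff _).2 ⟨g, Or.inr ⟨hg, rfl⟩⟩)) he.symm,
    fun g hg he => hn.2 _ _ (.recruit (h.status_single g hg)) he.symm⟩

/-- Queued departures are not later than the old time and `c` leaves after it, so appending its
group keeps the queue sorted. That no other event comes first gives the bounds for all remaining
clocks. -/
theorem depart (h : S.Matches z u X) (hu : ∀ c, 0 < u c) {g : Fin n} {c d : V}
    (hg : g ∉ S.queue) (hcd : (S.w₁ g = c ∧ S.w₂ g = d) ∨ (S.w₁ g = d ∧ S.w₂ g = c))
    (hn : IsNext z u X (.depart c) (z c)) :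
    Matches z u ⟨Function.update S.w₁ g d, Function.update S.w₂ g c, S.queue ++ [g], 0, S.clock⟩
      ⟨z c, Function.update X.status g (.single d (z c))⟩ := by
  obtain ⟨n1, n2, n3⟩ := h.next_lt hn
  have hne : ∀ g' ∈ S.queue, g' ≠ g := fun g' h1 h2 => hg (h2 ▸ h1)
  have hXc : X.time < z c := by
    rcases hcd with ⟨rfl, -⟩ | ⟨-, rfl⟩
    · exact h.time_lt₁ g
    · exact h.time_lt₂ g hg
  have hdc : z c < z d := by
    rcases hcd with ⟨rfl, rfl⟩ | ⟨rfl, rfl⟩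
    · exact n2 g hg fun e => h.ne _ _ (VCEvent.depart.inj e)
    · exact n1 g fun e => h.ne _ _ (VCEvent.depart.inj e).symm
  have hc1 : ∀ g', g' ≠ g → S.w₁ g' ≠ c ∧ S.w₁ g' ≠ d ∧ S.w₂ g' ≠ c ∧ S.w₂ g' ≠ d := by
    intro g' hg'
    rcases hcd with ⟨rfl, rfl⟩ | ⟨rfl, rfl⟩
    · exact ⟨fun e => hg' (h.inj₁ e), h.ne _ _, (h.ne _ _).symm, fun e => hg' (h.inj₂ e)⟩
    · exact ⟨h.ne _ _, fun e => hg' (h.inj₁ e), fun e => hg' (h.inj₂ e), (h.ne _ _).symm⟩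
  have hcd' : c ≠ d := fun e => hdc.ne (by rw [e])
  refine ⟨?_, ?_, ?_, ?_, ?_, ?_, ?_, ?_, ?_, ?_, ?_, ?_, ?_, ?_, ?_, ?_, ?_, ?_⟩
  · intro g' hg'
    simp only [List.mem_append, List.mem_singleton] at hg'
    by_cases e : g' = g
    · subst e; simp
    · simp [e, h.status_single g' (hg'.resolve_right e)]
  · intro g' hg'
    simp only [List.mem_append, List.mem_singleton, not_or] at hg'
    simpa [hg'.2] using h.status_pair g' hg'.1
  · intro a b e
    simp only [Function.update_apply] at e
    split_ifs at e with h1 h2 h2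
    · rw [h1, h2]
    · exact absurd e.symm (hc1 _ h2).2.1
    · exact absurd e (hc1 _ h1).2.1
    · exact h.inj₁ e
  · intro a b e
    simp only [Function.update_apply] at e
    split_ifs at e with h1 h2 h2
    · rw [h1, h2]
    · exact absurd e.symm (hc1 _ h2).2.2.1
    · exact absurd e (hc1 _ h1).2.2.1
    · exact h.inj₂ e
  · intro a b e
    simp only [Function.update_apply] at e
    split_ifs at e with h1 h2 h2
    · exact hcd' e.symm
    · exact (hc1 _ h2).2.2.2 e.symm
    · exact (hc1 _ h1).1 e
    · exact h.ne _ _ e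
  · exact List.nodup_append.2 ⟨h.nodup, List.nodup_singleton _, by simpa using hne⟩
  · refine List.pairwise_append.2 ⟨?_, List.pairwise_singleton _ _, ?_⟩
    · refine h.sorted.imp_of_mem fun {a b} ha hb hab => ?_
      simpa [hne a ha, hne b hb] using hab
    · intro a ha b hb
      rw [List.mem_singleton] at hb
      subst hb
      simpa [hne a ha] using (h.le_time a ha).trans_lt hXc
  · simp [Labels.time, labels]
  · intro g'
    by_cases e : g' = g
    · subst e; simpa using hdc
    · simpa [e] using n1 g' fun e' => (hc1 _ e).1 (VCEvent.depart.inj e').symm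
  · intro g' hg'
    simp only [List.mem_append, List.mem_singleton, not_or] at hg'
    simpa [hg'.2] using
      n2 g' hg'.1 fun e' => (hc1 _ hg'.2).2.2.1 (VCEvent.depart.inj e').symm
  · intro g' hg'
    simp only [List.mem_append, List.mem_singleton] at hg'
    by_cases e : g' = g
    · subst e; simp
    · simpa [e] using (h.le_time g' (hg'.resolve_right e)).trans hXc.le
  · intro g' hg'
    simp only [List.mem_append, List.mem_singleton] at hg'
    by_cases e : g' = g
    · subst e; simpa using hu d
    · simpa [e] using n3 g' (hg'.resolve_right e) (by simp)
  all_goals simp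

/-- The queue is sorted by departure, so the position of `g` counts the recruiters with an earlier
departure. Erasing `g` leaves the part before it and the part after it as the γ and ψ blocks. -/
theorem recruit (h : S.Matches z u X) {g : Fin n} {c y : V}
    (hg : g ∈ S.queue) (hc : S.w₁ g = c)
    (hn : IsNext z u X (.recruit c) (z (S.w₂ g) + u c)) (hy : ¬ X.Active y)
    (hyz : z (S.w₂ g) + u c < z y) :
    Matches z u ⟨S.w₁, Function.update S.w₂ g y, S.queue.erase g, S.queue.idxOf g + 1, (S.w₂ g, c)⟩
      ⟨z (S.w₂ g) + u c, Function.update X.status g (.pair c y)⟩ := by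
  obtain ⟨n1, n2, n3⟩ := h.next_lt hn
  subst hc
  have hXt : X.time < z (S.w₂ g) + u (S.w₁ g) := h.time_lt_recr g hg
  have hy1 : ∀ g', S.w₁ g' ≠ y := fun g' e => hy ((h.active_iff y).2 ⟨g', Or.inl e.symm⟩)
  -- The recruit is not a departed vehicle either: those have sojourn times up to the old time,
  -- whereas `y` outlasts the new one.
  have hy2 : ∀ g', S.w₂ g' ≠ y := fun g' e => by
    by_cases hg' : g' ∈ S.queue
    · have h1 := h.le_time g' hg'
      rw [e] at h1
      linarith
    · exact hy ((h.active_iff y).2 ⟨g', Or.inr ⟨hg', e.symm⟩⟩)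
  have hmem : ∀ g', g' ∈ S.queue.erase g ↔ g' ≠ g ∧ g' ∈ S.queue := fun g' =>
    h.nodup.mem_erase_iff
  obtain ⟨l₁, l₂, hl⟩ := List.append_of_mem hg
  have hnd := h.nodup
  have hso := h.sorted
  rw [hl] at hnd hso
  have hg1 : g ∉ l₁ := fun h1 => by
    rw [List.nodup_append] at hnd
    exact hnd.2.2 g h1 g (by simp) rfl
  have hg2 : g ∉ l₂ := by
    rw [List.nodup_append, List.nodup_cons] at hnd
    exact hnd.2.1.1
  have her : S.queue.erase g = l₁ ++ l₂ := by
    rw [hl, List.erase_append_right _ hg1, List.erase_cons_head]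
  have hidx : S.queue.idxOf g = l₁.length := by
    rw [hl, List.idxOf_append_of_notMem hg1, List.idxOf_cons_self, Nat.add_zero]
  rw [List.pairwise_append, List.pairwise_cons] at hso
  refine ⟨?_, ?_, ?_, ?_, ?_, ?_, ?_, ?_, ?_, ?_, ?_, ?_, ?_, ?_, ?_, ?_, ?_, ?_⟩
  · intro g' hg'
    obtain ⟨e, hg'⟩ := (hmem g').1 hg'
    simp [e, h.status_single g' hg']
  · intro g' hg'
    by_cases e : g' = g
    · subst e; simp
    · simpa [e] using h.status_pair g' fun h1 => hg' ((hmem g').2 ⟨e, h1⟩)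
  · exact h.inj₁
  · intro a b e
    simp only [Function.update_apply] at e
    split_ifs at e with h1 h2 h2
    · rw [h1, h2]
    · exact absurd e.symm (hy2 _)
    · exact absurd e (hy2 _)
    · exact h.inj₂ e
  · intro a b e
    simp only [Function.update_apply] at e
    split_ifs at e
    · exact hy1 _ e
    · exact h.ne _ _ e
  · exact h.nodup.erase g
  · refine (h.sorted.sublist List.erase_sublist).imp_of_mem fun {a b} ha hb hab => ?_
    simpa [((hmem a).1 ha).1, ((hmem b).1 hb).1] using hab
  · simp [Labels.time, labels, Labels.clockZ, Labels.clockU]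
  · exact fun g' => n1 g' (by simp)
  · intro g' hg'
    by_cases e : g' = g
    · subst e; simpa using hyz
    · simpa [e] using n2 g' (fun h1 => hg' ((hmem g').2 ⟨e, h1⟩)) (by simp)
  · intro g' hg'
    obtain ⟨e, hg'⟩ := (hmem g').1 hg'
    simpa [e] using (h.le_time g' hg').trans hXt.le
  · intro g' hg'
    obtain ⟨e, hg'⟩ := (hmem g').1 hg'
    simpa [e] using n3 g' hg' fun e' => e (h.inj₁ (VCEvent.recruit.inj e').symm)
  · intro _ g' hg'
    obtain ⟨e, hg'⟩ := (hmem g').1 hg'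
    exact fun e' => e (h.inj₁ e')
  · intro _ g' hg'
    simp only [her, hidx, Nat.add_sub_cancel, List.take_left] at hg'
    have e : g' ≠ g := fun e => hg1 (e ▸ hg')
    simpa [e] using hso.2.2 g' hg' g (by simp)
  · intro _ g' hg'
    simp only [her, hidx, Nat.add_sub_cancel, List.drop_left] at hg'
    have e : g' ≠ g := fun e => hg2 (e ▸ hg')
    simpa [e] using hso.2.1.1 g' hg'
  · intro _ g' hg'
    obtain ⟨e, hg'⟩ := (hmem g').1 hg'
    simpa [e] using (h.le_time g' hg').trans_lt hXt
  · simp [her, hidx]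
  · intro _
    have h1 := length_queue_le h.nodup
    simp only [her]
    rw [hl] at h1
    simp at h1 ⊢
    omega

/-- A vehicle belongs to only one group, so the choice made in `after` is forced. -/
theorem symStep_unique (h : S.Matches z u X) {m : Move V} {S₁ S₂ : SymConfig V n}
    (h₁ : SymStep S m S₁) (h₂ : SymStep S m S₂) : S₁ = S₂ := by
  cases h₁ with
  | @depart g c d hg hc =>
    cases h₂ with
    | @depart g' _ d' hg' hc' =>
      have : g = g' ∧ d = d' := by
        rcases hc with ⟨rfl, rfl⟩ | ⟨rfl, rfl⟩ <;> rcases hc' with ⟨e, rfl⟩ | ⟨rfl, e⟩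
        · obtain rfl := h.inj₁ e; exact ⟨rfl, rfl⟩
        · exact absurd e.symm (h.ne _ _)
        · exact absurd e (h.ne _ _)
        · obtain rfl := h.inj₂ e; exact ⟨rfl, rfl⟩
      rw [this.1, this.2]
  | @recruit g c y hg hc =>
    cases h₂ with
    | @recruit g' _ _ hg' hc' =>
      rw [h.inj₁ (hc.trans hc'.symm)]

theorem step (h : S.Matches z u X) (hu : ∀ c, 0 < u c) {m : Move V} {X' : VCConfig V n}
    (hs : Step z u X m (some X')) : ∃ S', SymStep S m S' ∧ S'.Matches z u X' := by
  cases hs with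
  | departLeft hg hn =>
    obtain ⟨h1, h2⟩ := h.of_pair hg
    exact ⟨_, .depart h1 h2, h.depart hu h1 h2 hn⟩
  | departRight hg hn =>
    obtain ⟨h1, h2⟩ := h.of_pair hg
    exact ⟨_, .depart h1 h2.symm, h.depart hu h1 h2.symm hn⟩
  | recruit hg hn hy hz =>
    obtain ⟨h1, rfl, rfl⟩ := (h.single_iff _ _ _).1 hg
    exact ⟨_, .recruit h1 rfl, h.recruit h1 rfl hn hy hz⟩

end Matches

/-- The initial symbolic configuration. -/
def initial (alloc : Fin n → Fin 2 → V) (hn : 0 < n) : SymConfig V n where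
  w₁ g := alloc g 0
  w₂ g := alloc g 1
  queue := []
  j := 0
  clock := (alloc ⟨0, hn⟩ 0, alloc ⟨0, hn⟩ 0)

theorem matches_initial {alloc : Fin n → Fin 2 → V} (ha : Function.Injective (Function.uncurry alloc))
    (hn : 0 < n) {z u : V → ℝ} (hz : ∀ c, 0 < z c) :
    (initial alloc hn).Matches z u ⟨0, fun g => .pair (alloc g 0) (alloc g 1)⟩ := by
  have hi : ∀ g g' a b, alloc g a = alloc g' b → g = g' ∧ a = b := fun g g' a b e =>
    Prod.ext_iff.1 (ha (a₁ := (g, a)) (a₂ := (g', b)) e)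
  constructor <;> simp [initial, hz, Labels.time]
  · exact fun a b e => (hi _ _ _ _ e).1
  · exact fun a b e => (hi _ _ _ _ e).1
  · exact fun g g' e => by simpa using (hi _ _ _ _ e).2

theorem matches_after {alloc : Fin n → Fin 2 → V} (ha : Function.Injective (Function.uncurry alloc))
    (hn : 0 < n) {z u : V → ℝ} (hz : ∀ c, 0 < z c) (hu : ∀ c, 0 < u c) {h : List (Move V)}
    {X : VCConfig V n} (hr : Run z u alloc h (some X)) :
    ((initial alloc hn).after h).Matches z u X := by
  generalize hY : some X = Y at hr
  induction hr generalizing X with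
  | start =>
    cases hY
    exact matches_initial ha hn hz
  | step hr hs ih =>
    subst hY
    obtain ⟨S', h1, h2⟩ := (ih rfl).step hu hs
    rw [(ih rfl).symStep_unique (symStep_after _ _ _ h1) h1]
    exact h2

end SymConfig

/-! ### The next event -/

namespace Labels

variable {V : Type*} {n i j : ℕ} {L : Labels V n i j}

/-- The times at which the entries of the lists run out. -/
def clockTime (L : Labels V n i j) (z u : V → ℝ) : Fin (2 * n - i) ⊕ Fin i → ℝ :=
  Sum.elim (fun k => z (L.act k)) (fun k => z (L.orig k) + u (L.recr k))

/-- The events which correspond to the entries of the lists. -/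
def clockEvent (L : Labels V n i j) : Fin (2 * n - i) ⊕ Fin i → VCEvent V :=
  Sum.elim (fun k => .depart (L.act k)) (fun k => .recruit (L.recr k))

/-- Each entry carries its own sojourn time, that of an active vehicle or of an origin, so
genericity applies even if recruitment durations coincide. -/
theorem clockTime_injective (hL : L.Distinct) {z u : V → ℝ} (hg : Generic z u) :
    Function.Injective (L.clockTime z u) := by
  rintro (a | a) (b | b) e <;> by_contra h
  · exact hg.z_ne_z _ _ (fun e' => h (by rw [hL.act_inj e'])) e
  · exact hg.z_ne_zu _ _ _ (hL.act_ne_orig a b) e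
  · exact hg.z_ne_zu _ _ _ (hL.act_ne_orig b a) e.symm
  · exact hg.zu_ne_zu _ _ _ _ (fun e' => h (by rw [hL.orig_inj e'])) e

theorem elim_values (z u : V → ℝ) (x : Fin (2 * n - i) ⊕ Fin i) :
    Sum.elim (L.desc.values z u).1 (L.desc.values z u).2 x = L.clockTime z u x - L.time z u := by
  cases x with
  | inl k => exact eval_sojourn L z u k
  | inr k => exact eval_recruitment L z u k

end Labels

theorem Step.ne_none_of_recruit {V : Type*} {n : ℕ} {z u : V → ℝ} {X : VCConfig V n} {c y : V}
    {X' : Option (VCConfig V n)} (hs : Step z u X (.recruit c y) X') : X' ≠ none := by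
  cases hs
  simp

namespace SymConfig.Matches

variable {V : Type*} {n : ℕ} {z u : V → ℝ} {S : SymConfig V n} {X : VCConfig V n}

theorem pending_iff (h : S.Matches z u X) (hu : ∀ c, 0 < u c) (e : VCEvent V) (t : ℝ) :
    Pending z u X e t ↔ ∃ x, S.labels.clockEvent x = e ∧ S.labels.clockTime z u x = t := by
  have hd := h.describes hu
  constructor
  · rintro (@⟨c, hc⟩ | @⟨g, c, s, hg⟩)
    · obtain ⟨k, rfl⟩ := (hd.vehicle_iff c).1 hc
      exact ⟨Sum.inl k, rfl, rfl⟩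
    · obtain ⟨h1, rfl, rfl⟩ := (h.single_iff _ _ _).1 hg
      obtain ⟨k, rfl⟩ := List.get_of_mem h1
      exact ⟨Sum.inr k, rfl, rfl⟩
  · rintro ⟨k | k, rfl, rfl⟩
    · exact .depart ((hd.vehicle_iff _).2 ⟨k, rfl⟩)
    · exact .recruit (h.status_single _ (List.get_mem S.queue k))

theorem existsUnique_next (h : S.Matches z u X) (hn : 0 < n) (hg : Generic z u) :
    ∃! e, ∃ t, IsNext z u X e t := by
  have hl := length_queue_le h.nodup
  have : Nonempty (Fin (2 * n - S.queue.length) ⊕ Fin S.queue.length) :=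
    ⟨Sum.inl ⟨0, by omega⟩⟩
  have hp := h.pending_iff hg.pos_u
  obtain ⟨x, hx⟩ := Finite.exists_min (S.labels.clockTime z u)
  have hi := Labels.clockTime_injective (h.distinct hg.pos_u) hg
  refine ⟨S.labels.clockEvent x, ⟨S.labels.clockTime z u x, (hp _ _).2 ⟨x, rfl, rfl⟩, ?_⟩, ?_⟩
  · intro e' t' hp' hne
    obtain ⟨y, rfl, rfl⟩ := (hp _ _).1 hp'
    exact lt_of_le_of_ne (hx y) fun e => hne (by rw [hi e])
  · rintro e' ⟨t', hp', hmin⟩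
    obtain ⟨y, rfl, rfl⟩ := (hp _ _).1 hp'
    by_contra hne
    exact absurd (hmin _ _ ((hp _ _).2 ⟨x, rfl, rfl⟩) fun e => hne e.symm) (not_lt.2 (hx y))

theorem eq_none_iff (h : S.Matches z u X) {c : V} {X' : Option (VCConfig V n)}
    (hs : Step z u X (.depart c) X') : X' = none ↔ ∃ k, S.labels.recr k = c := by
  have hr : (∃ k, S.labels.recr k = c) ↔ ∃ g ∈ S.queue, S.w₁ g = c := by
    constructor
    · rintro ⟨k, rfl⟩
      exact ⟨_, List.get_mem S.queue k, rfl⟩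
    · rintro ⟨g, hg, rfl⟩
      obtain ⟨k, rfl⟩ := List.get_of_mem hg
      exact ⟨k, rfl⟩
  rw [hr]
  have key : ∀ g d, g ∉ S.queue → ((S.w₁ g = c ∧ S.w₂ g = d) ∨ (S.w₁ g = d ∧ S.w₂ g = c)) →
      ¬ ∃ g ∈ S.queue, S.w₁ g = c := by
    rintro g d h1 h2 ⟨g', h3, h4⟩
    rcases h2 with ⟨h2, -⟩ | ⟨-, h2⟩
    · exact h1 (h.inj₁ (h4.trans h2.symm) ▸ h3)
    · exact h.ne _ _ (h4.trans h2.symm)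
  cases hs with
  | departLeft hg _ =>
    obtain ⟨h1, h2⟩ := h.of_pair hg
    simpa using key _ _ h1 h2
  | departRight hg _ =>
    obtain ⟨h1, h2⟩ := h.of_pair hg
    simpa using key _ _ h1 h2.symm
  | fail hg _ =>
    obtain ⟨h1, h2, -⟩ := (h.single_iff _ _ _).1 hg
    simpa using ⟨_, h1, h2.symm⟩

end SymConfig.Matches

/-! ### The total mass of the kernel -/

theorem dTarget_mem_dStates {n i : ℕ} (hi : i ≤ n) (e : Fin (2 * n - i) ⊕ Fin i) :
    dTarget n i e ∈ dStates n := by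
  have key : ∀ a b, a ≤ n → (a, b) ∈ hStates n a → DState.H a b ∈ dStates n := fun a b ha hb =>
    Finset.mem_insert_of_mem (Finset.mem_biUnion.2 ⟨a, Finset.mem_range.2 (by omega),
      Finset.mem_image.2 ⟨(a, b), hb, rfl⟩⟩)
  cases e with
  | inl k =>
    have := k.2
    rw [dTarget]
    split_ifs with h
    · exact Finset.mem_insert_self _ _
    · refine key _ _ (by omega) ?_
      rw [hStates]
      split_ifs with h1
      · simp
      · simp; omega
  | inr k =>
    have := k.2
    refine key _ _ (by omega) ?_
    rw [hStates, if_pos (by omega)]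
    simp
    omega

/-- As `t` grows the time bound disappears, leaving the events that the strict minimum leads to `s`.
They are disjoint, and they cover almost everything because finitely many distinct values have a
strict minimum. -/
theorem sum_iSup_dKernel {n : ℕ} (ν : ∀ i _j : ℕ, Measure (Residuals n i)) {i : ℕ} (j : ℕ)
    (hi : i ≤ n) (hn : 0 < n) [IsProbabilityMeasure (ν i j)]
    (hν : ∀ᵐ p ∂(ν i j), Function.Injective (Sum.elim p.1 p.2)) :
    ∑ s ∈ dStates n, ⨆ t : ℝ, dKernel n ν i j s t = 1 := by
  let E : DState → Set (Residuals n i) := fun s => {p | ∃ e, dTarget n i e = s ∧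
    ∀ e', e' ≠ e → Sum.elim p.1 p.2 e < Sum.elim p.1 p.2 e'}
  have hE : ∀ s, ⨆ t : ℝ, dKernel n ν i j s t = ν i j (E s) := by
    intro s
    simp only [dKernel]
    rw [← Monotone.measure_iUnion]
    · congr 1
      ext p
      simp only [Set.mem_iUnion, Set.mem_ofPred_eq, E]
      constructor
      · rintro ⟨t, e, h1, -, h2⟩
        exact ⟨e, h1, h2⟩
      · rintro ⟨e, h1, h2⟩
        exact ⟨_, e, h1, le_rfl, h2⟩
    · rintro t t' htt' p ⟨e, h1, h2, h3⟩
      exact ⟨e, h1, h2.trans htt', h3⟩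
  have hm : ∀ e, Measurable fun p : Residuals n i => Sum.elim p.1 p.2 e := by
    rintro (k | k)
    · exact (measurable_pi_apply k).comp measurable_fst
    · exact (measurable_pi_apply k).comp measurable_snd
  have hEm : ∀ s, MeasurableSet (E s) := by
    intro s
    have : E s = ⋃ e, ⋃ (_ : dTarget n i e = s), ⋂ e', ⋂ (_ : e' ≠ e),
        {p | Sum.elim p.1 p.2 e < Sum.elim p.1 p.2 e'} := by
      ext p
      simp only [E, Set.mem_iUnion, Set.mem_iInter, Set.mem_ofPred_eq, exists_prop]
    rw [this]
    exact MeasurableSet.iUnion fun e => MeasurableSet.iUnion fun _ => MeasurableSet.iInter fun e' =>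
      MeasurableSet.iInter fun _ => measurableSet_lt (hm e) (hm e')
  simp only [hE]
  rw [← measure_biUnion_finset ?_ fun s _ => hEm s]
  · have : Nonempty (Fin (2 * n - i) ⊕ Fin i) := ⟨Sum.inl ⟨0, by omega⟩⟩
    rw [← measure_univ (μ := ν i j)]
    refine measure_congr (Filter.eventuallyEq_univ.2 ?_)
    filter_upwards [hν] with p hp
    obtain ⟨e, he⟩ := Finite.exists_min (Sum.elim p.1 p.2)
    exact Set.mem_biUnion (dTarget_mem_dStates hi e)
      ⟨e, rfl, fun e' hne => lt_of_le_of_ne (he e') fun h => hne (hp h).symm⟩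
  · intro s _ s' _ hss
    refine Set.disjoint_left.2 ?_
    rintro p ⟨e, rfl, h1⟩ ⟨e', rfl, h2⟩
    have hne : e ≠ e' := fun h => hss (by rw [h])
    exact lt_asymm (h1 e' hne.symm) (h2 e hne)

theorem Labels.ae_injective_jointLaw {Ω V : Type*} [Countable V] [MeasurableSpace Ω]
    {μ : Measure Ω} [IsProbabilityMeasure μ] {Z U : V → Ω → ℝ} {lam : ℝ} {R : Measure ℝ}
    (H : IsSeSVC μ Z U lam R) (hR : R (Set.Iic 0) = 0) {n i j : ℕ} {L : Labels V n i j}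
    (hL : L.Distinct) :
    ∀ᵐ p ∂(L.desc.jointLaw μ Z U), Function.Injective (Sum.elim p.1 p.2) := by
  have hm := measurable_values H.measurable_elim L.desc
  rw [HDesc.jointLaw]
  refine (ae_map_iff hm.aemeasurable ?_).2 ?_
  · have hm' : ∀ e, Measurable fun p : Residuals n i => Sum.elim p.1 p.2 e := by
      rintro (k | k)
      · exact (measurable_pi_apply k).comp measurable_fst
      · exact (measurable_pi_apply k).comp measurable_snd
    have : {p : Residuals n i | Function.Injective (Sum.elim p.1 p.2)} =
        ⋂ e, ⋂ e', ⋂ (_ : e ≠ e'), {p | Sum.elim p.1 p.2 e = Sum.elim p.1 p.2 e'}ᶜ := by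
      ext p
      simp only [Set.mem_iInter, Set.mem_compl_iff, Set.mem_ofPred_eq]
      exact ⟨fun h e e' hne he => hne (h he), fun h e e' he => by_contra fun hne => h e e' hne he⟩
    exact this ▸ MeasurableSet.iInter fun e => MeasurableSet.iInter fun e' =>
      MeasurableSet.iInter fun _ => (measurableSet_eq_fun (hm' e) (hm' e')).compl
  -- Conditioning preserves null sets, and all residuals are event times minus one common time.
  · refine cond_absolutelyContinuous.ae_le ?_
    filter_upwards [H.ae_generic hR] with ω hω e e' he
    rw [elim_values, elim_values] at he
    exact clockTime_injective hL hω (sub_left_injective he)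

/-! ### Assembly of the decomposition theorem -/

theorem card_hStates {n i : ℕ} (h : i < n) : (hStates n i).card = i + 2 := by
  rw [hStates, if_pos h, Finset.card_image_of_injective _ (Prod.mk_right_injective i),
    Finset.card_range]

theorem theorem1 (n : ℕ) (hn : 0 < n) (lam : ℝ) (hlam : 0 < lam)
    (R : Measure ℝ) [IsProbabilityMeasure R] (hR : R (Set.Iic 0) = 0) :
    -- each `S_i` is decomposed into `i + 2` H-states, except for `S_n`
    ((∀ i < n, (hStates n i).card = i + 2) ∧ (hStates n n).card = 1) ∧
    -- laws of the residual times in the H-states, depending on `n`, `lam` and `R` only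
    ∃ ν : ∀ i _j : ℕ, Measure (Residuals n i),
      ∀ (Ω : Type*) [MeasurableSpace Ω] (μ : Measure Ω) [IsProbabilityMeasure μ]
        (V : Type*) [Countable V] (Z U : V → Ω → ℝ) (_ : IsSeSVC μ Z U lam R)
        (alloc : Fin n → Fin 2 → V) (_ : Function.Injective (Function.uncurry alloc)),
        -- the H-state reached after each history, and its description
        ∃ (hs : List (Move V) → ℕ × ℕ) (desc : ∀ h, HDesc V n (hs h).1),
          hs [] = (0, 0) ∧
          (∀ᵐ ω ∂μ, ∀ (h : List (Move V)) (X : VCConfig V n),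
            Run (fun c => Z c ω) (fun c => U c ω) alloc h (some X) →
              (hs h).1 = X.level ∧ hs h ∈ hStates n X.level ∧
              (desc h).Describes (fun c => Z c ω) (fun c => U c ω) X ∧
              (desc h).IsHState μ Z U lam R ω (hs h).2 ∧
              (∀ k, (desc h).order (fun c => Z c ω) (fun c => U c ω) k = k + 1) ∧
              -- exactly one of the scheduled events occurs next
              (∃! e, ∃ t, IsNext (fun c => Z c ω) (fun c => U c ω) X e t) ∧
              -- transitions
              (∀ c X', Step (fun c => Z c ω) (fun c => U c ω) X (.depart c) (some X') →
                hs (h ++ [.depart c]) = ((hs h).1 + 1, 0)) ∧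
              (∀ k y X', Step (fun c => Z c ω) (fun c => U c ω) X
                  (.recruit ((desc h).recruiter k) y) X' →
                X' ≠ none ∧ hs (h ++ [.recruit ((desc h).recruiter k) y]) =
                  ((hs h).1 - 1,
                    (desc h).order (fun c => Z c ω) (fun c => U c ω) k)) ∧
              (∀ c X', Step (fun c => Z c ω) (fun c => U c ω) X (.depart c) X' →
                (X' = none ↔ ∃ k, (desc h).recruiter k = c))) ∧
          -- time-homogeneity: the joint law of the lists depends on the H-state only, and the
          -- kernel of the decomposed process which these laws determine has total mass one
          (∀ h, μ {ω | ∃ X, Run (fun c => Z c ω) (fun c => U c ω) alloc h (some X)} ≠ 0 →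
            (desc h).jointLaw μ Z U = ν (hs h).1 (hs h).2 ∧
            ∑ s ∈ dStates n, ⨆ t : ℝ, dKernel n ν (hs h).1 (hs h).2 s t = 1) := by
  refine ⟨⟨fun i hi => card_hStates hi, by simp [hStates]⟩, hLaw n lam R, ?_⟩
  intro Ω _ μ _ V _ Z U H alloc ha
  let S : List (Move V) → SymConfig V n := (SymConfig.initial alloc hn).after
  refine ⟨fun h => ((S h).queue.length, (S h).j), fun h => (S h).labels.desc, rfl, ?_, ?_⟩
  · filter_upwards [H.ae_generic hR] with ω hω h X hr
    have hM : (S h).Matches _ _ X := SymConfig.matches_after ha hn hω.pos_z hω.pos_u hr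
    have hD := hM.distinct hω.pos_u
    have hA := hM.admissible hω.pos_z hω.pos_u
    refine ⟨hM.level_eq.symm, hM.level_eq ▸ hM.mem_hStates, hM.describes hω.pos_u,
      Labels.isHState hD H hR hM.j_le hA, hA.order_eq hD, hM.existsUnique_next hn hω, ?_, ?_, ?_⟩
    · intro c X' hs
      obtain ⟨S', h1, -⟩ := hM.step hω.pos_u hs
      have h2 := SymConfig.symStep_after _ _ _ h1
      change ((SymConfig.after _ _).queue.length, (SymConfig.after _ _).j) = _
      rw [hM.symStep_unique h2 h1]
      cases h1
      simp
    · intro k y X' hs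
      have hne := hs.ne_none_of_recruit
      obtain ⟨X', rfl⟩ := Option.ne_none_iff_exists'.1 hne
      refine ⟨hne, ?_⟩
      obtain ⟨S', h1, -⟩ := hM.step hω.pos_u hs
      have h2 := SymConfig.symStep_after _ _ _ h1
      rw [hA.order_eq hD]
      change ((SymConfig.after _ _).queue.length, (SymConfig.after _ _).j) = _
      rw [hM.symStep_unique h2 h1]
      cases h1 with
      | @recruit g _ _ hg hc =>
        obtain rfl := hM.inj₁ hc
        simp [hM.nodup.idxOf_getElem]
    · exact fun c X' hs => hM.eq_none_iff hs
  · intro h h0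
    -- One generic outcome realizing the history suffices: distinctness of the labels does not
    -- depend on the outcome.
    have hex : ∃ ω, Generic (fun c => Z c ω) (fun c => U c ω) ∧
        ∃ X, Run (fun c => Z c ω) (fun c => U c ω) alloc h (some X) := by
      by_contra hno
      refine h0 (measure_mono_null (fun ω hω => ?_) (ae_iff.1 (H.ae_generic hR)))
      exact fun hg => hno ⟨ω, hg, hω⟩
    obtain ⟨ω, hω, X, hr⟩ := hex
    have hM : (S h).Matches _ _ X := SymConfig.matches_after ha hn hω.pos_z hω.pos_u hr
    have hD := hM.distinct hω.pos_u
    have hlaw := Labels.jointLaw_eq H hD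
    refine ⟨hlaw, ?_⟩
    have hinj := Labels.ae_injective_jointLaw H hR hD
    -- Up to a null set the history implies the defining relations, so these have positive
    -- probability and the conditioned law has mass one.
    have hpos : μ {ω | (S h).labels.desc.Relations (fun c => Z c ω) (fun c => U c ω)} ≠ 0 := by
      intro hzero
      have hsub : {ω | ∃ X, Run (fun c => Z c ω) (fun c => U c ω) alloc h (some X)} ⊆
          {ω | (S h).labels.desc.Relations (fun c => Z c ω) (fun c => U c ω)} ∪
          {ω | ¬ Generic (fun c => Z c ω) (fun c => U c ω)} := by
        rintro ω ⟨X, hr⟩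
        by_cases hω : Generic (fun c => Z c ω) (fun c => U c ω)
        · have hM : (S h).Matches _ _ X := SymConfig.matches_after ha hn hω.pos_z hω.pos_u hr
          exact Or.inl ((hM.admissible hω.pos_z hω.pos_u).relations hD)
        · exact Or.inr hω
      exact h0 (measure_mono_null hsub (measure_union_null hzero (ae_iff.1 (H.ae_generic hR))))
    have hprob : IsProbabilityMeasure ((S h).labels.desc.jointLaw μ Z U) := by
      have := cond_isProbabilityMeasure hpos
      exact Measure.isProbabilityMeasure_map (measurable_values H.measurable_elim _).aemeasurable
    rw [hlaw] at hinj hprob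
    exact sum_iSup_dKernel _ _ (SymConfig.length_queue_le hM.nodup) hn hinj
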